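/- Let $\mathcal{A}$ be a finite alphabet and let $\eta\colon\mathbb{Z}^2\to\mathcal{A}$. For $\vec u\in\mathbb{Z}^2$ write $(T^{\vec u}\eta)(\vec x)=\eta(\vec x+\vec u)$, and let $X_\eta$ be the closure of $\{T^{\vec u}\eta : \vec u\in\mathbb{Z}^2\}$ in $\mathcal{A}^{\mathbb{Z}^2}$ with the product topology ($\mathcal{A}$ being discrete). A line $\ell\subset\mathbb{R}^2$ is called a nonexpansive line for $\eta$ if for every $r\in\mathbb{R}$ there exist $f_r,g_r\in X_\eta$ with $f_r\neq g_r$ such that $f_r(\vec u)=g_r(\vec u)$ for all $\vec u\in\mathbb{Z}^2$ with $d(\vec u,\ell)<r$, where $d$ is the Euclidean distance. This property is invariant under translations of $\ell$, and nonexpansive lines are counted up to translation, that is, among the lines through the origin. For a finite set $S\subset\mathbb{Z}^2$ let $P_\eta(S)$ be the number of distinct restrictions $(T^{\vec u}\eta)|_S$, $\vec u\in\mathbb{Z}^2$, and let $R_{n,3}=\{0,\dots,n-1\}\times\{0,1,2\}$. If there are exactly three nonexpansive lines for $\eta$, then $P_\eta(R_{n,3})>3n$ for every $n\in\mathbb{N}$.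 -/

import Mathlib

namespace Nivat

/-- The lattice `ℤ²`. -/
abbrev Lattice : Type := ℤ × ℤ

/-- The plane `ℝ²` with its Euclidean distance. -/
abbrev Plane : Type := EuclideanSpace ℝ (Fin 2)

/-- The inclusion of `ℤ²` into `ℝ²`. -/
noncomputable def toPlane (u : Lattice) : Plane := !₂[(u.1 : ℝ), (u.2 : ℝ)]

/-- The translation action `(T^u η)(x) = η (x + u)`. -/
def translate {A : Type*} (u : Lattice) (η : Lattice → A) : Lattice → A :=
  fun x => η (x + u)

/-- The orbit closure `X_η` of `η`, in the product topology on `A^(ℤ²)` where the alphabet `A`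
has the discrete topology. -/
def orbitClosure {A : Type*} (η : Lattice → A) : Set (Lattice → A) :=
  letI : TopologicalSpace A := ⊥
  closure (Set.range fun u : Lattice => translate u η)

/-- The set `W_η(S)` of `S`-words of `η`: all restrictions `(T^u η)|_S`, for `u` in `ℤ²`. -/
def words {A : Type*} (η : Lattice → A) (S : Finset Lattice) : Set (S → A) :=
  Set.range fun u : Lattice => fun x : S => translate u η x

/-- The complexity `P_η(S)`, the number of `S`-words of `η`
(a finite number as soon as the alphabet is finite). -/
noncomputable def complexity {A : Type*} (η : Lattice → A) (S : Finset Lattice) : ℕ :=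
  (words η S).ncard

/-- The `n` by `k` rectangle `R_{n,k}` of width `n` and height `k`. -/
noncomputable def rect (n k : ℕ) : Finset Lattice :=
  Finset.Ico (0 : ℤ) n ×ˢ Finset.Ico (0 : ℤ) k

/-- `ℓ` is a nonexpansive line for `η`: it is a line in `ℝ²`, and for every real `r` there are two
different elements of `X_η` that agree at all lattice points at distance less than `r` from `ℓ`. -/
def IsNonexpansiveLine {A : Type*} (η : Lattice → A) (ℓ : AffineSubspace ℝ Plane) : Prop :=
  Module.finrank ℝ ℓ.direction = 1 ∧
    ∀ r : ℝ, ∃ f ∈ orbitClosure η, ∃ g ∈ orbitClosure η, f ≠ g ∧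
      ∀ u : Lattice, Metric.infDist (toPlane u) (ℓ : Set Plane) < r → f u = g u

/-- The nonexpansive lines for `η` through the origin. As nonexpansiveness of a line is invariant
under translations of `ℝ²`, nonexpansive lines are counted up to translation. -/
def nonexpansiveLines {A : Type*} (η : Lattice → A) : Set (AffineSubspace ℝ Plane) :=
  {ℓ | IsNonexpansiveLine η ℓ ∧ (0 : Plane) ∈ ℓ}

end Nivat

/-! Encode letters as integers, let Laurent polynomials in X and Y act on configurations by shifts,
and suppose that R_{n,3} has at most 3n words. The constant function and the 3n coordinate functions
on words are then linearly dependent, so a nonzero integer polynomial F supported on R_{n,3} maps η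
to a constant (`exists_integer_annihilator`).

A nonexpansive line yields, by compactness, a nonzero limit e of differences of translates of η that
vanishes on an open half plane. Reduction modulo large primes makes e periodic along the boundary of
the half plane, and a Fourier coefficient in that direction shows that every annihilator of η
vanishes on a curve x^v₁ y^v₂ = ω with |ω| = 1 and v primitive along the line
(`IsNonexpansiveLine.exists_vanishOnCurve`). Three lines give three such curves, pairwise disjoint
over |x| > 1, while F has degree at most 2 in Y. Hence two of the curves are graphs y = αx^p and y =
βx^q with p < q (`exists_two_graphs`), and F = h(X)(Y - αX^p)(Y - βX^q) (`row_relations`).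

The contradiction comes from quadratic functions of the words. With h of least width, so many
products of two linear functions of a word fit into R_{n,3} that they also satisfy a linear relation
(`exists_product_relations`). Applying annihilators to it leaves products φ'(i)ψ'(j) of one-variable
functions that are periodic under simultaneous translation of i and j. This makes h(X)(Y - βX^q)η or
h(X)(Y - αX^p)η horizontally periodic, so η has an annihilator that cannot vanish on the remaining
curve (`false_of_product_relations`). -/

namespace Nivat

/-! ### Laurent polynomials acting by shifts -/

section Action

variable {k G : Type*} [CommRing k] [AddCommGroup G]

/-- The shift action of `G` on functions `G → k`. -/
def shiftHom (k G : Type*) [CommRing k] [AddCommGroup G] :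
    Multiplicative G →* Module.End k (G → k) where
  toFun g := LinearMap.funLeft k k fun u => u + g.toAdd
  map_one' := by
    ext e u
    simp [LinearMap.funLeft]
  map_mul' g h := by
    refine LinearMap.ext fun e => funext fun u => ?_
    simp [LinearMap.funLeft_apply, add_assoc]

/-- The action of Laurent polynomials on configurations by shifts. -/
noncomputable def act : AddMonoidAlgebra k G →ₐ[k] Module.End k (G → k) :=
  AddMonoidAlgebra.lift k (Module.End k (G → k)) G (shiftHom k G)

theorem act_apply (f : AddMonoidAlgebra k G) (e : G → k) (u : G) :
    act f e u = f.coeff.sum fun s c => c * e (u + s) := by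
  rw [act, AddMonoidAlgebra.lift_apply, Finsupp.sum, LinearMap.sum_apply, Finset.sum_apply]
  rfl

theorem act_single (s : G) (c : k) (e : G → k) (u : G) :
    act (AddMonoidAlgebra.single s c) e u = c * e (u + s) := by
  rw [act, AddMonoidAlgebra.lift_single]
  rfl

theorem act_mul (f g : AddMonoidAlgebra k G) (e : G → k) : act (f * g) e = act f (act g e) := by
  rw [map_mul]; rfl

theorem act_comm (f g : AddMonoidAlgebra k G) (e : G → k) :
    act f (act g e) = act g (act f e) := by
  rw [← act_mul, mul_comm, act_mul]

theorem act_sub_left (f g : AddMonoidAlgebra k G) (e : G → k) :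
    act (f - g) e = act f e - act g e := by
  rw [map_sub]; rfl

theorem act_translate (f : AddMonoidAlgebra k G) (e : G → k) (t : G) :
    act f (fun u => e (u + t)) = fun u => act f e (u + t) := by
  funext u
  simp only [act_apply, add_right_comm]

theorem act_congr_at {f : AddMonoidAlgebra k G} {e e' : G → k} {u v : G}
    (h : ∀ s ∈ f.coeff.support, e (u + s) = e' (v + s)) : act f e u = act f e' v := by
  rw [act_apply, act_apply]
  exact Finset.sum_congr rfl fun s hs => by simp only [h s hs]

/-- `single s 1 - 1` kills constants. -/
theorem act_single_sub_one_const (s : G) (c : k) :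
    act (AddMonoidAlgebra.single s 1 - 1) (fun _ => c) = 0 := by
  rw [act_sub_left, map_one]
  funext u
  simp [act_single]

end Action

/-! ### Linear recurrences over finite value sets -/

section Recurrence

variable {k : Type*} [CommRing k] [IsDomain k]

/-- The extreme coefficients are nonzero, so each term is determined by the `hi - lo` terms before
it, and equally by those after it. Zeros on one window spread both ways. -/
theorem eq_zero_of_act_eq_zero {g : AddMonoidAlgebra k ℤ} {lo hi : ℤ}
    (hlo : g.coeff lo ≠ 0) (hhi : g.coeff hi ≠ 0)
    (hsupp : ∀ s ∈ g.coeff.support, lo ≤ s ∧ s ≤ hi)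
    {b : ℤ → k} (hb : act g b = 0) {x : ℤ} (hx : ∀ i, x ≤ i → i < x + (hi - lo) → b i = 0) :
    b = 0 := by
  have key : ∀ (n t : ℤ), g.coeff t ≠ 0 →
      (∀ s ∈ g.coeff.support, s ≠ t → b (n + s) = 0) → b (n + t) = 0 := by
    intro n t ht h
    have h1 := congrFun hb n
    rw [act_apply, Finsupp.sum, Finset.sum_eq_single t] at h1
    · simpa [ht] using h1
    · intro s hs hst
      rw [h s hs hst, mul_zero]
    · intro h2
      simp at h2
      exact absurd h2 ht
  have fwd : ∀ m : ℕ, ∀ i, x ≤ i → i < x + (hi - lo) + m → b i = 0 := by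
    intro m
    induction m with
    | zero => intro i h1 h2; exact hx i h1 (by simpa using h2)
    | succ m ih =>
      intro i h1 h2
      rcases lt_or_ge i (x + (hi - lo) + m) with h | h
      · exact ih i h1 h
      · have := key (i - hi) hi hhi fun s hs hne => by
          have := hsupp s hs
          push_cast at h2
          exact ih _ (by omega) (by omega)
        simpa using this
  have bwd : ∀ m : ℕ, ∀ i, x - m ≤ i → i < x + (hi - lo) → b i = 0 := by
    intro m
    induction m with
    | zero => intro i h1 h2; exact hx i (by simpa using h1) h2
    | succ m ih =>
      intro i h1 h2
      rcases lt_or_ge i (x - m) with h | h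
      · have := key (i - lo) lo hlo fun s hs hne => by
          have := hsupp s hs
          push_cast at h1
          exact ih _ (by omega) (by omega)
        simpa using this
      · exact ih i h h2
  funext i
  rcases lt_or_ge i x with h | h
  · rcases lt_or_ge i (x + (hi - lo)) with h' | h'
    · exact bwd (x - i).toNat i (by omega) h'
    · have := hsupp lo (by simpa using hlo)
      omega
  · exact fwd (i - x + 1).toNat i h (by have := hsupp lo (by simpa using hlo); omega)

/-- Sequences with values in a finite set that satisfy a fixed recurrence have a common period. -/
theorem exists_common_period {g : AddMonoidAlgebra k ℤ} (hg : g ≠ 0) {D : Set k} (hD : D.Finite) :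
    ∃ K : ℕ, 0 < K ∧ ∀ a : ℤ → k, (∀ n, a n ∈ D) → act g a = 0 → ∀ n, a (n + K) = a n := by
  classical
  have hne : g.coeff.support.Nonempty := by
    rw [Finsupp.support_nonempty_iff]
    simpa using hg
  set lo := g.coeff.support.min' hne
  set hi := g.coeff.support.max' hne
  have hlo : g.coeff lo ≠ 0 := by simpa using g.coeff.support.min'_mem hne
  have hhi : g.coeff hi ≠ 0 := by simpa using g.coeff.support.max'_mem hne
  have hs : ∀ s ∈ g.coeff.support, lo ≤ s ∧ s ≤ hi := fun s hs =>
    ⟨Finset.min'_le _ _ hs, Finset.le_max' _ _ hs⟩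
  have := hD.fintype
  set N := Fintype.card (Fin (hi - lo).toNat → D)
  -- `N` counts windows of length `hi - lo` over `D`. Two of `N + 1` consecutive windows of `a`
  -- agree, which gives a period of at most `N`; the factorial is a multiple of all of these and
  -- does not depend on `a`.
  refine ⟨N.factorial, N.factorial_pos, fun a ha hga => ?_⟩
  obtain ⟨i, j, hij, hw⟩ := Fintype.exists_ne_map_eq_of_card_lt
    (fun (n : Fin (N + 1)) (t : Fin (hi - lo).toNat) => (⟨a ((n : ℕ) + (t : ℕ)), ha _⟩ : D))
    (by simp [N])
  wlog hlt : i < j generalizing i j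
  · exact this j i hij.symm hw.symm (lt_of_le_of_ne (not_lt.mp hlt) hij.symm)
  have hdiff : (fun u => a (u + (j : ℕ)) - a (u + (i : ℕ))) = (0 : ℤ → k) := by
    refine eq_zero_of_act_eq_zero hlo hhi hs (x := 0) ?_ ?_
    · have : (fun u : ℤ => a (u + (j : ℕ)) - a (u + (i : ℕ)))
          = (fun u => a (u + (j : ℕ))) - fun u => a (u + (i : ℕ)) := rfl
      rw [this, map_sub, act_translate, act_translate, hga]
      funext u
      simp
    · intro t h0 h1
      have h2 := congrFun hw ⟨t.toNat, by omega⟩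
      simp only [Subtype.mk.injEq] at h2
      have h3 : ((t.toNat : ℕ) : ℤ) = t := by omega
      rw [h3] at h2
      simp only [add_comm t, h2, sub_self]
  have hper : Function.Periodic a (((j : ℕ) - (i : ℕ) : ℕ) : ℤ) := by
    intro n
    have h1 := congrFun hdiff (n - (i : ℕ))
    have hlt' : (i : ℕ) < j := hlt
    simp only [Pi.zero_apply, sub_add_cancel, sub_eq_zero] at h1
    rw [← h1]
    congr 1
    omega
  have hdvd : ((j : ℕ) - (i : ℕ)) ∣ N.factorial :=
    Nat.dvd_factorial (Nat.sub_pos_of_lt hlt) (by have := j.2; omega)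
  obtain ⟨q, hq⟩ := hdvd
  intro n
  have h2 := (hper.nat_mul q) n
  rw [hq]
  push_cast at h2 ⊢
  rw [mul_comm] at h2
  exact h2

end Recurrence

/-! ### Substituting X^p into an annihilator -/

section Frobenius

variable {G : Type*} [AddCommGroup G]

/-- A bounded integer configuration annihilated by `f(X)` is annihilated by `f(X^p)` for all large
primes `p`. -/
theorem act_pow_prime_eq_zero (f : AddMonoidAlgebra ℤ G) {e : G → ℤ} {B : ℤ}
    (he : ∀ u, |e u| ≤ B) (hfe : act f e = 0) :
    ∃ N : ℕ, ∀ p : ℕ, p.Prime → N < p → ∀ u, ∑ s ∈ f.coeff.support, f.coeff s * e (u + p • s) = 0 := by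
  -- A bound for the absolute value of the sum: beyond it, divisibility by `p` forces zero.
  refine ⟨(∑ s ∈ f.coeff.support, |f.coeff s| * B).toNat, fun p hp hN u => ?_⟩
  have : Fact p.Prime := ⟨hp⟩
  have : CharP (AddMonoidAlgebra (ZMod p) G) p :=
    charP_of_injective_algebraMap (algebraMap (ZMod p) _).injective p
  set F : AddMonoidAlgebra (ZMod p) G :=
    ∑ s ∈ f.coeff.support, AddMonoidAlgebra.single s (f.coeff s : ZMod p) with hF
  have hact : act F (fun u => (e u : ZMod p)) = 0 := by
    funext v
    rw [hF, map_sum, LinearMap.sum_apply, Finset.sum_apply]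
    simp only [act_single]
    have := congrFun hfe v
    rw [act_apply] at this
    have h2 := congrArg (Int.cast : ℤ → ZMod p) this
    simpa [Finsupp.sum] using h2
  -- In characteristic `p` the power is additive and fixes the coefficients, so F(X)^p = F(X^p).
  have hpow : F ^ p = ∑ s ∈ f.coeff.support, AddMonoidAlgebra.single (p • s) (f.coeff s : ZMod p) := by
    rw [hF, sum_pow_char]
    refine Finset.sum_congr rfl fun s _ => ?_
    rw [AddMonoidAlgebra.single_pow, ZMod.pow_card]
  have hact2 : act (F ^ p) (fun u => (e u : ZMod p)) = 0 := by
    rw [← pow_sub_one_mul hp.ne_zero F, act_mul, hact, map_zero]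
  have hmod := congrFun hact2 u
  rw [hpow, map_sum, LinearMap.sum_apply, Finset.sum_apply] at hmod
  simp only [act_single, Pi.zero_apply] at hmod
  have hdvd : (p : ℤ) ∣ ∑ s ∈ f.coeff.support, f.coeff s * e (u + p • s) := by
    rw [← ZMod.intCast_zmod_eq_zero_iff_dvd]
    push_cast
    exact hmod
  refine Int.eq_zero_of_abs_lt_dvd hdvd ?_
  calc |∑ s ∈ f.coeff.support, f.coeff s * e (u + p • s)|
      ≤ ∑ s ∈ f.coeff.support, |f.coeff s * e (u + p • s)| := Finset.abs_sum_le_sum_abs _ _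
    _ ≤ ∑ s ∈ f.coeff.support, |f.coeff s| * B := by
        refine Finset.sum_le_sum fun s _ => ?_
        rw [abs_mul]
        exact mul_le_mul_of_nonneg_left (he _) (abs_nonneg _)
    _ < p := by omega

end Frobenius

/-! ### Rows of a two-variable polynomial -/

section Rows

variable {k : Type*} [CommRing k]

/-- The `b`-th row of a Laurent polynomial in two variables. -/
noncomputable def row (f : AddMonoidAlgebra k (ℤ × ℤ)) (b : ℤ) : AddMonoidAlgebra k ℤ :=
  AddMonoidAlgebra.ofCoeff
    (f.coeff.comapDomain (fun a => (a, b)) fun _ _ _ _ h => (Prod.ext_iff.mp h).1)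

@[simp]
theorem coeff_row (f : AddMonoidAlgebra k (ℤ × ℤ)) (b a : ℤ) :
    (row f b).coeff a = f.coeff (a, b) := rfl

theorem sum_row (f : AddMonoidAlgebra k (ℤ × ℤ)) (b : ℤ) (h : ℤ → k) :
    ((row f b).coeff.sum fun a c => c * h a)
      = ∑ s ∈ f.coeff.support with s.2 = b, f.coeff s * h s.1 := by
  rw [Finsupp.sum]
  refine Finset.sum_bij' (fun a _ => (a, b)) (fun s _ => s.1) ?_ ?_ ?_ ?_ ?_
  · intro a ha
    simpa using ha
  · rintro ⟨a, b'⟩ hs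
    simp only [Finset.mem_filter] at hs
    obtain ⟨hs, rfl⟩ := hs
    simpa using hs
  · intro a _; rfl
  · rintro ⟨a, b'⟩ hs
    simp only [Finset.mem_filter] at hs
    obtain ⟨hs, rfl⟩ := hs
    rfl
  · intro a _; rfl

theorem sum_eq_sum_rows (f : AddMonoidAlgebra k (ℤ × ℤ)) (h g : ℤ → k) {T : Finset ℤ}
    (hT : ∀ s ∈ f.coeff.support, s.2 ∈ T) :
    (f.coeff.sum fun s c => c * (h s.1 * g s.2))
      = ∑ b ∈ T, g b * (row f b).coeff.sum fun a c => c * h a := by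
  rw [Finsupp.sum, ← Finset.sum_fiberwise_of_maps_to hT]
  refine Finset.sum_congr rfl fun b _ => ?_
  rw [sum_row, Finset.mul_sum]
  refine Finset.sum_congr rfl fun s hs => ?_
  rw [(Finset.mem_filter.mp hs).2]
  ring

theorem row_ne_zero_of_mem {f : AddMonoidAlgebra k (ℤ × ℤ)} {s : ℤ × ℤ}
    (hs : s ∈ f.coeff.support) : row f s.2 ≠ 0 := by
  intro h
  have h2 : (row f s.2).coeff s.1 = 0 := by rw [h]; rfl
  rw [coeff_row] at h2
  simp at hs
  exact hs h2

end Rows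

/-! ### Annihilated configurations supported on a half plane -/

section HalfPlane

theorem sum_range_periodic_shift {K : ℕ} {h : ℤ → ℂ} (hper : ∀ n, h (n + K) = h n) (a : ℤ) :
    ∑ i ∈ Finset.range K, h (i + a) = ∑ i ∈ Finset.range K, h i := by
  have step : ∀ a : ℤ, ∑ i ∈ Finset.range K, h (i + (a + 1)) = ∑ i ∈ Finset.range K, h (i + a) := by
    intro a
    have h1 := Finset.sum_range_succ (fun i : ℕ => h (i + a)) K
    rw [Finset.sum_range_succ'] at h1
    have h2 : h ((K : ℤ) + a) = h (((0 : ℕ) : ℤ) + a) := by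
      rw [add_comm, hper]; simp
    rw [h2] at h1
    have h3 := add_right_cancel h1
    rw [← h3]
    refine Finset.sum_congr rfl fun i _ => ?_
    congr 1
    push_cast
    ring
  induction a with
  | zero => simp
  | succ n ih => rw [step, ih]
  | pred n ih =>
    rw [← ih, ← step]
    refine Finset.sum_congr rfl fun i _ => ?_
    congr 1
    ring

/-- A bounded integer configuration supported on a half plane with an integer annihilator is
horizontally periodic. -/
theorem exists_horizontal_period {f : AddMonoidAlgebra ℤ (ℤ × ℤ)} (hf : f ≠ 0) {e : ℤ × ℤ → ℤ}
    {B : ℤ} (he : ∀ u, |e u| ≤ B) (hfe : act f e = 0) (hneg : ∀ a b, b < 0 → e (a, b) = 0) :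
    ∃ K : ℕ, 0 < K ∧ ∀ a b, e (a + K, b) = e (a, b) := by
  have hne : f.coeff.support.Nonempty := by
    rw [Finsupp.support_nonempty_iff]
    simpa using hf
  obtain ⟨s₀, hs₀, hmax⟩ := Finset.exists_max_image f.coeff.support (fun s => s.2) hne
  obtain ⟨K, hK, hper⟩ := exists_common_period (row_ne_zero_of_mem hs₀)
    (D := Set.Icc (-B) B) (Set.finite_Icc _ _)
  obtain ⟨N, hN⟩ := act_pow_prime_eq_zero f he hfe
  refine ⟨K, hK, fun a b => ?_⟩
  -- Place the top row of f(X^p) at height `b`. Its other rows land at height at most b - p < 0,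
  -- where `e` vanishes, so the top row alone gives a recurrence for row `b` of `e` along steps of
  -- `p`. The period `K` of that recurrence does not depend on `p` or `b`.
  have hp : ∀ p : ℕ, p.Prime → N < p → b < p → Function.Periodic (fun a => e (a, b)) (p * K : ℤ) := by
    intro p hp h1 h2 a
    have h3 := hper (fun n => e (a + p * n, b)) (fun n => abs_le.mp (he _)) ?_ 0
    · simpa using h3
    · funext n
      rw [act_apply, sum_row (h := fun m => e (a + p * (n + m), b))]
      have h4 := hN p hp h1 (a + p * n, b - p * s₀.2)
      rw [← Finset.sum_filter_add_sum_filter_not _ (fun s => s.2 = s₀.2)] at h4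
      have hz : ∑ s ∈ f.coeff.support with ¬ s.2 = s₀.2,
          f.coeff s * e ((a + p * n, b - p * s₀.2) + p • s) = 0 := by
        refine Finset.sum_eq_zero fun s hs => ?_
        have h5 := (Finset.mem_filter.mp hs)
        have h6 := lt_of_le_of_ne (hmax s h5.1) h5.2
        have : e ((a + p * n, b - p * s₀.2) + p • s) = 0 := by
          refine hneg _ _ ?_
          have : (p : ℤ) * (s.2 + 1) ≤ p * s₀.2 := by
            have : s.2 + 1 ≤ s₀.2 := h6
            exact mul_le_mul_of_nonneg_left this (by positivity)
          change b - p * s₀.2 + p • s.2 < 0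
          rw [nsmul_eq_mul]
          linarith
        rw [this, mul_zero]
      rw [hz, add_zero] at h4
      rw [Pi.zero_apply, ← h4]
      refine Finset.sum_congr rfl fun s hs => ?_
      have h5 := (Finset.mem_filter.mp hs).2
      congr 2
      refine Prod.ext ?_ ?_
      · simp; ring
      · simp [h5]
  -- Two distinct primes give the periods pK and qK, and Bézout gives K.
  obtain ⟨p, hp1, hp2⟩ := Nat.exists_infinite_primes (N + b.toNat + 1)
  obtain ⟨q, hq1, hq2⟩ := Nat.exists_infinite_primes (p + 1)
  have hcop : IsCoprime (p : ℤ) (q : ℤ) := by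
    rw [Nat.isCoprime_iff_coprime, Nat.coprime_primes hp2 hq2]
    omega
  obtain ⟨x, y, hxy⟩ := hcop
  have h1 := (hp p hp2 (by omega) (by omega)).int_mul x
  have h2 := (hp q hq2 (by omega) (by omega)).int_mul y
  have h3 := h1.add_period h2
  have h4 : (x : ℤ) * (p * K) + y * (q * K) = K := by linear_combination (K : ℤ) * hxy
  simp only [Int.cast_id] at h3
  rw [h4] at h3
  exact h3 a

/-- A bounded integer configuration supported on a half plane, with an integer annihilator, forces
a common zero of all its annihilators. -/
theorem exists_common_zero_of_half_plane {f : AddMonoidAlgebra ℤ (ℤ × ℤ)} (hf : f ≠ 0)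
    {e : ℤ × ℤ → ℤ} {B : ℤ} (he : ∀ u, |e u| ≤ B) (hfe : act f e = 0)
    (hneg : ∀ a b, b < 0 → e (a, b) = 0) (h0 : e (0, 0) ≠ 0) :
    ∃ ω : ℂ, ‖ω‖ = 1 ∧ ∀ F : AddMonoidAlgebra ℂ (ℤ × ℤ), act F (fun u => (e u : ℂ)) = 0 →
      ∀ z : ℂ, (F.coeff.sum fun s c => c * (ω ^ s.1 * z ^ s.2)) = 0 := by
  obtain ⟨K, hK, hper⟩ := exists_horizontal_period hf he hfe hneg
  have hK0 : K ≠ 0 := hK.ne'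
  -- A polynomial of degree below `K` with constant coefficient `e (0, 0) ≠ 0` cannot vanish at all
  -- `K`-th roots of unity.
  obtain ⟨ζ, hζ, hζ0⟩ : ∃ ζ : ℂ, ζ ^ K = 1 ∧ ∑ i ∈ Finset.range K, (e (i, 0) : ℂ) * ζ ^ i ≠ 0 := by
    by_contra! hall
    set P : Polynomial ℂ := ∑ i ∈ Finset.range K, Polynomial.monomial i (e (i, 0) : ℂ) with hP
    have hdeg : P.natDegree < K := by
      refine Nat.lt_of_le_pred hK (Polynomial.natDegree_sum_le_of_forall_le _ _ fun i hi => ?_)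
      exact (Polynomial.natDegree_monomial_le _).trans (Nat.le_pred_of_lt (Finset.mem_range.mp hi))
    have hz := Polynomial.eq_zero_of_natDegree_lt_card_of_eval_eq_zero' P
      (Polynomial.nthRootsFinset K (1 : ℂ)) (fun z hz => by
        have := hall z ((Polynomial.mem_nthRootsFinset hK _).mp hz)
        simpa [hP, Polynomial.eval_finsetSum] using this)
      (by rw [(Complex.isPrimitiveRoot_exp K hK0).card_nthRootsFinset]; exact hdeg)
    have h1 : P.coeff 0 = 0 := by rw [hz]; simp
    rw [hP, Polynomial.finsetSum_coeff, Finset.sum_eq_single 0] at h1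
    · simp at h1
      exact h0 h1
    · intro i _ hi
      rw [Polynomial.coeff_monomial, if_neg hi]
    · intro h; simp [hK0] at h
  have hζne : ζ ≠ 0 := by
    rintro rfl
    rw [zero_pow hK0] at hζ
    exact zero_ne_one hζ
  set E : ℤ → ℂ := fun b => ∑ i ∈ Finset.range K, (e (i, b) : ℂ) * ζ ^ (i : ℤ) with hE
  have hshift : ∀ a b : ℤ, ∑ i ∈ Finset.range K, (e (i + a, b) : ℂ) * ζ ^ (i : ℤ)
      = ζ⁻¹ ^ a * E b := by
    intro a b
    have := sum_range_periodic_shift (K := K) (h := fun i => (e (i, b) : ℂ) * ζ ^ i) (fun n => by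
      simp only [hper, zpow_add₀ hζne, zpow_natCast, hζ, mul_one]) a
    rw [hE]
    simp only
    rw [← this, Finset.mul_sum]
    refine Finset.sum_congr rfl fun i _ => ?_
    rw [zpow_add₀ hζne, inv_zpow]
    have : ζ ^ a ≠ 0 := zpow_ne_zero _ hζne
    field_simp
  refine ⟨ζ⁻¹, ?_, fun F hF z => ?_⟩
  · rw [norm_inv, Complex.norm_eq_one_of_pow_eq_one hζ hK0, inv_one]
  set T := F.coeff.support.image Prod.snd
  have hT : ∀ s ∈ F.coeff.support, s.2 ∈ T := fun s hs => Finset.mem_image_of_mem _ hs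
  set R : ℤ → ℂ := fun b => (row F b).coeff.sum fun a c => c * ζ⁻¹ ^ a with hR
  -- The horizontal Fourier transform of the equation `act F e = 0`.
  have hrel : ∀ j, ∑ b ∈ T, E (j + b) * R b = 0 := by
    intro j
    rw [← sum_eq_sum_rows F (fun a => ζ⁻¹ ^ a) (fun b => E (j + b)) hT]
    simp only [← hshift, Finsupp.sum, Finset.mul_sum]
    rw [Finset.sum_comm]
    refine Finset.sum_eq_zero fun i _ => ?_
    have h1 := congrFun hF ((i : ℤ), j)
    rw [act_apply, Finsupp.sum, Pi.zero_apply] at h1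
    have h2 := congrArg (· * ζ ^ (i : ℤ)) h1
    simp only [zero_mul, Finset.sum_mul] at h2
    rw [← h2]
    refine Finset.sum_congr rfl fun s _ => ?_
    rw [mul_assoc]
    rfl
  -- `E` vanishes at negative indices and `E 0 ≠ 0`. If `b` is the largest index with `R b ≠ 0`, the
  -- relation at `-b` reduces to `E 0 * R b = 0`.
  have hR0 : ∀ b ∈ T, R b = 0 := by
    by_contra! hcon
    obtain ⟨b₀, hb₀, hb₀'⟩ := hcon
    obtain ⟨b, hb, hbmax⟩ := Finset.exists_max_image (T.filter fun b => R b ≠ 0) id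
      ⟨b₀, by simp [hb₀, hb₀']⟩
    rw [Finset.mem_filter] at hb
    have h1 := hrel (-b)
    rw [Finset.sum_eq_single b] at h1
    · simp only [neg_add_cancel] at h1
      rcases mul_eq_zero.mp h1 with h2 | h2
      · apply hζ0
        simpa [hE] using h2
      · exact hb.2 h2
    · intro c hc hcb
      by_cases hRc : R c = 0
      · rw [hRc, mul_zero]
      · have h2 : c ≤ b := hbmax c (by simp [hc, hRc])
        have h3 : E (-b + c) = 0 := by
          rw [hE]
          refine Finset.sum_eq_zero fun i _ => ?_
          rw [hneg _ _ (by omega)]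
          simp
        rw [h3, zero_mul]
    · intro h; exact absurd hb.1 h
  rw [sum_eq_sum_rows F (fun a => ζ⁻¹ ^ a) (fun b => z ^ b) hT]
  exact Finset.sum_eq_zero fun b hb => by
    have := hR0 b hb
    rw [hR] at this
    simp only at this
    rw [this, mul_zero]

end HalfPlane

/-! ### Finite patterns in the orbit closure -/

section Closure

variable {A : Type*} {η : Lattice → A}

theorem exists_eq_on_of_mem_orbitClosure {x : Lattice → A} (hx : x ∈ orbitClosure η)
    (S : Finset Lattice) : ∃ t, ∀ s ∈ S, x s = η (s + t) := by
  let : TopologicalSpace A := ⊥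
  have : DiscreteTopology A := ⟨rfl⟩
  have hx' : x ∈ closure (Set.range fun u : Lattice => translate u η) := hx
  rw [mem_closure_iff] at hx'
  obtain ⟨y, hy, t, rfl⟩ := hx' ((S : Set Lattice).pi fun s => {x s})
    (isOpen_set_pi S.finite_toSet fun _ _ => isOpen_discrete _) fun s _ => rfl
  exact ⟨t, fun s hs => (hy s hs).symm⟩

end Closure

/-! ### Limits of differences of translates -/

section Difference

variable {A : Type*}

/-- `e` looks locally like a difference of two translates of `ι ∘ η`. -/
def IsLocalDifference (ι : A → ℤ) (η : Lattice → A) (e : Lattice → ℤ) : Prop :=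
  ∀ S : Finset Lattice, ∃ t t', ∀ s ∈ S, e s = ι (η (s + t)) - ι (η (s + t'))

/-- The value of `act F` at a point involves finitely many cells, on which `e` is a difference of
two translates. -/
theorem IsLocalDifference.act_eq_zero {k : Type*} [CommRing k] {ι : A → ℤ} {η : Lattice → A}
    {e : Lattice → ℤ} (h : IsLocalDifference ι η e) {F : AddMonoidAlgebra k Lattice}
    (hF : act F (fun u => (ι (η u) : k)) = 0) : act F (fun u => (e u : k)) = 0 := by
  classical
  funext u
  obtain ⟨t, t', ht⟩ := h (F.coeff.support.image fun s => u + s)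
  have h1 : act F (fun u => (e u : k)) u
      = act F ((fun v => (ι (η (v + t)) : k)) - fun v => (ι (η (v + t')) : k)) u := by
    refine act_congr_at fun s hs => ?_
    rw [ht (u + s) (Finset.mem_image_of_mem _ hs)]
    simp
  have h2 : ∀ t, act F (fun v => (ι (η (v + t)) : k)) = 0 := fun t => by
    rw [act_translate F (fun v => (ι (η v) : k)), hF]; rfl
  rw [h1, map_sub, h2, h2]
  simp

variable [Finite A]

/-- A limit of translated differences: if elements of the orbit closure agree on arbitrarily wide
strips `|N| < n` but differ somewhere in `N > 0`, there is a local difference that vanishes on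
`N < 0` but not at `0`. -/
theorem exists_isLocalDifference (ι : A → ℤ) (hι : Function.Injective ι) (η : Lattice → A)
    (N : Lattice →+ ℝ)
    (h : ∀ n : ℕ, ∃ f ∈ orbitClosure η, ∃ g ∈ orbitClosure η,
      (∀ u, |N u| < n → f u = g u) ∧ ∃ u, 0 < N u ∧ f u ≠ g u) :
    ∃ e, IsLocalDifference ι η e ∧ e 0 ≠ 0 ∧ ∀ u, N u < 0 → e u = 0 := by
  have h' : ∀ n : ℕ, ∃ e : Lattice → ℤ, IsLocalDifference ι η e ∧ e 0 ≠ 0 ∧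
      ∀ u, -(n : ℝ) < N u → N u ≤ - (1 / ((n : ℝ) + 1)) → e u = 0 := by
    intro n
    obtain ⟨f, hf, g, hg, hag, u₁, hu₁, hne₁⟩ := h n
    set V : Set ℝ := N '' {u | 0 < N u ∧ f u ≠ g u}
    have hbd : BddBelow V := ⟨0, by rintro _ ⟨u, hu, rfl⟩; exact hu.1.le⟩
    -- For irrational slope the infimum need not be attained; a point within `1 / (n + 1)` of it is
    -- moved to the origin, and the error disappears in the limit.
    obtain ⟨_, ⟨u₀, hu₀, rfl⟩, hlt⟩ := exists_lt_of_csInf_lt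
      (s := V) ⟨_, u₁, ⟨hu₁, hne₁⟩, rfl⟩ (b := sInf V + 1 / ((n : ℝ) + 1))
      (lt_add_of_pos_right _ (by positivity))
    have hn : (n : ℝ) ≤ N u₀ := by
      by_contra hcon
      exact hu₀.2 (hag u₀ (by rw [abs_of_pos hu₀.1]; exact not_le.mp hcon))
    refine ⟨fun u => ι (f (u + u₀)) - ι (g (u + u₀)), ?_, ?_, ?_⟩
    · intro S
      classical
      obtain ⟨t, ht⟩ := exists_eq_on_of_mem_orbitClosure hf (S.image (· + u₀))
      obtain ⟨t', ht'⟩ := exists_eq_on_of_mem_orbitClosure hg (S.image (· + u₀))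
      refine ⟨u₀ + t, u₀ + t', fun s hs => ?_⟩
      have hm := Finset.mem_image_of_mem (· + u₀) hs
      change ι (f (s + u₀)) - ι (g (s + u₀)) = _
      rw [ht _ hm, ht' _ hm, add_assoc, add_assoc]
    · change ι (f (0 + u₀)) - ι (g (0 + u₀)) ≠ 0
      rw [zero_add, sub_ne_zero]
      exact fun h => hu₀.2 (hι h)
    · intro u h1 h2
      by_contra hcon
      have h3 : N (u + u₀) ∈ V := by
        refine ⟨_, ⟨?_, ?_⟩, rfl⟩
        · rw [map_add]; linarith
        · intro h; exact hcon (by simp only [h, sub_self])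
      have h4 := csInf_le hbd h3
      rw [map_add] at h4
      linarith
  choose e hloc h0 hneg using h'
  have hD : (Set.range fun p : A × A => ι p.1 - ι p.2).Finite := Set.finite_range _
  have hval : ∀ n u, e n u ∈ Set.range fun p : A × A => ι p.1 - ι p.2 := by
    intro n u
    obtain ⟨t, t', ht⟩ := hloc n {u}
    exact ⟨(_, _), (ht u (Finset.mem_singleton_self u)).symm⟩
  -- Only finitely many values occur, so pointwise limits along a nonprincipal ultrafilter exist.
  have hlim : ∀ u, ∃ d, ∀ᶠ n in (Filter.hyperfilter ℕ : Filter ℕ), e n u = d := by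
    intro u
    obtain ⟨d, -, hd⟩ := (Ultrafilter.eventually_exists_mem_iff (f := Filter.hyperfilter ℕ)
      (P := fun d n => e n u = d) hD).mp
      (Filter.Eventually.of_forall fun n => ⟨_, hval n u, rfl⟩)
    exact ⟨d, hd⟩
  choose E hE using hlim
  have hle : (Filter.hyperfilter ℕ : Filter ℕ) ≤ Filter.atTop := by
    rw [← Nat.cofinite_eq_atTop]; exact Filter.hyperfilter_le_cofinite
  refine ⟨E, ?_, ?_, ?_⟩
  · intro S
    obtain ⟨n, hn⟩ := ((Filter.eventually_all_finset S).mpr fun s _ => hE s).exists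
    obtain ⟨t, t', ht⟩ := hloc n S
    exact ⟨t, t', fun s hs => by rw [← ht s hs, hn s hs]⟩
  · obtain ⟨n, hn⟩ := (hE 0).exists
    rw [← hn]
    exact h0 n
  · intro u hu
    have h1 : ∀ᶠ n : ℕ in Filter.atTop, -(n : ℝ) < N u :=
      (tendsto_natCast_atTop_atTop.eventually_gt_atTop (-N u)).mono fun n hn => by linarith
    have h2 : ∀ᶠ n : ℕ in Filter.atTop, N u ≤ -(1 / ((n : ℝ) + 1)) :=
      (tendsto_one_div_add_atTop_nhds_zero_nat.eventually_lt_const (neg_pos.mpr hu)).mono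
        fun n hn => by linarith
    obtain ⟨n, ⟨hn1, hn2⟩, hn3⟩ := (((h1.and h2).filter_mono hle).and (hE u)).exists
    rw [← hn3]
    exact hneg n u hn1 hn2

end Difference

/-! ### From a general half plane to a horizontal one -/

section ChangeOfCoordinates

variable {k G H : Type*} [CommRing k] [AddCommGroup G] [AddCommGroup H]

theorem act_mapDomain (φ : G →+ H) (f : AddMonoidAlgebra k G) (e : H → k) (u : G) :
    act (AddMonoidAlgebra.mapDomain φ f) e (φ u) = act f (fun v => e (φ v)) u := by
  rw [act_apply, act_apply, AddMonoidAlgebra.coeff_mapDomain, Finsupp.sum_mapDomain_index]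
  · simp only [map_add]
  · simp
  · intro s a b; ring

/-- The real functional `u ↦ d.1 * u.2 - d.2 * u.1` on the lattice. -/
def normalForm (d : ℝ × ℝ) : Lattice →+ ℝ where
  toFun u := d.1 * u.2 - d.2 * u.1
  map_zero' := by simp
  map_add' u v := by simp; ring

theorem normalForm_apply (d : ℝ × ℝ) (u : Lattice) : normalForm d u = d.1 * u.2 - d.2 * u.1 := rfl

/-- A local difference supported on a half plane has rational boundary line, and gives a common
zero of all annihilators. -/
theorem exists_direction_and_common_zero {A : Type*} [Finite A] {ι : A → ℤ} {η : Lattice → A}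
    {d : ℝ × ℝ} (hd : d ≠ 0) {e : Lattice → ℤ} (he : IsLocalDifference ι η e) (he0 : e 0 ≠ 0)
    (hneg : ∀ u, normalForm d u < 0 → e u = 0)
    {f : AddMonoidAlgebra ℤ Lattice} (hf : f ≠ 0) (hfη : act f (fun u => ι (η u)) = 0) :
    ∃ v : Lattice, IsCoprime v.1 v.2 ∧ normalForm d v = 0 ∧ ∃ ω : ℂ, ‖ω‖ = 1 ∧
      ∀ F : AddMonoidAlgebra ℂ Lattice, act F (fun u => (ι (η u) : ℂ)) = 0 →
        ∀ x y : ℂ, x ≠ 0 → y ≠ 0 → x ^ v.1 * y ^ v.2 = ω →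
          (F.coeff.sum fun s c => c * (x ^ s.1 * y ^ s.2)) = 0 := by
  have hfe : act f e = 0 := by
    have := he.act_eq_zero (k := ℤ) (F := f) (by simpa using hfη)
    simpa using this
  obtain ⟨B, hB⟩ : ∃ B : ℤ, ∀ u, |e u| ≤ B := by
    have hD : (Set.range fun p : A × A => |ι p.1 - ι p.2|).Finite := Set.finite_range _
    obtain ⟨B, hB⟩ := hD.bddAbove
    refine ⟨B, fun u => hB ?_⟩
    obtain ⟨t, t', ht⟩ := he {u}
    exact ⟨(_, _), by rw [ht u (Finset.mem_singleton_self u)]⟩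
  set N := normalForm d
  -- Otherwise `N` is injective on the lattice. Translating the `N`-maximal point `s₀` of the
  -- support of `f` to the origin puts all other support points where `e` vanishes, and `act f e
  -- (-s₀)` is the nonzero term `f.coeff s₀ * e 0`.
  obtain ⟨v₀, hv₀, hNv₀⟩ : ∃ v : Lattice, v ≠ 0 ∧ N v = 0 := by
    have hne : f.coeff.support.Nonempty := by
      rw [Finsupp.support_nonempty_iff]; simpa using hf
    obtain ⟨s₀, hs₀, hmax⟩ := Finset.exists_max_image f.coeff.support N hne
    by_contra! hcon
    have h1 := congrFun hfe (-s₀)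
    rw [act_apply, Finsupp.sum, Finset.sum_eq_single s₀] at h1
    · simp only [neg_add_cancel, Pi.zero_apply] at h1
      rcases mul_eq_zero.mp h1 with h2 | h2
      · simp at hs₀; exact hs₀ h2
      · exact he0 h2
    · intro s hs hss
      have h2 : N (-s₀ + s) ≠ 0 := hcon _ (by rwa [Ne, neg_add_eq_zero, eq_comm])
      have h3 : N (-s₀ + s) ≤ 0 := by
        rw [map_add, map_neg]; linarith [hmax s hs]
      rw [hneg _ (lt_of_le_of_ne h3 h2), mul_zero]
    · intro h; exact absurd hs₀ h
  -- A primitive `v` on the boundary, completed to a basis of ℤ² by `(-b, a)`, which points into the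
  -- half plane `N > 0`.
  obtain ⟨v, a, b, hab, hNv, hNw⟩ : ∃ (v : Lattice) (a b : ℤ), a * v.1 + b * v.2 = 1 ∧ N v = 0 ∧
      0 < N (-b, a) := by
    have hg : Int.gcd v₀.1 v₀.2 ≠ 0 := by
      intro h
      rw [Int.gcd_eq_zero_iff] at h
      exact hv₀ (Prod.ext h.1 h.2)
    obtain ⟨v₁, v₂, hcop, h1, h2⟩ := Int.exists_gcd_one (Nat.pos_of_ne_zero hg)
    have hg' : ((Int.gcd v₀.1 v₀.2 : ℤ) : ℝ) ≠ 0 := by exact_mod_cast hg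
    have hN1 : N (v₁, v₂) = 0 := by
      have : N v₀ = N (v₁, v₂) * ((Int.gcd v₀.1 v₀.2 : ℤ) : ℝ) := by
        rw [normalForm_apply, normalForm_apply]
        have h1' : (v₀.1 : ℝ) = v₁ * ((Int.gcd v₀.1 v₀.2 : ℤ) : ℝ) := by exact_mod_cast h1
        have h2' : (v₀.2 : ℝ) = v₂ * ((Int.gcd v₀.1 v₀.2 : ℤ) : ℝ) := by exact_mod_cast h2
        linear_combination d.1 * h2' - d.2 * h1'
      rw [hNv₀] at this
      exact (mul_eq_zero.mp this.symm).resolve_right hg'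
    obtain ⟨a, b, hab⟩ := Int.isCoprime_iff_gcd_eq_one.mpr hcop
    rw [normalForm_apply] at hN1
    simp only at hN1
    have habR : (a : ℝ) * v₁ + b * v₂ = 1 := by exact_mod_cast hab
    have hNw : N (-b, a) ≠ 0 := by
      intro h
      rw [normalForm_apply] at h
      push_cast at h
      refine hd (Prod.ext ?_ ?_)
      · change d.1 = 0
        linear_combination (v₁ : ℝ) * h - d.1 * habR + b * hN1
      · change d.2 = 0
        linear_combination (v₂ : ℝ) * h - d.2 * habR - a * hN1
    rcases lt_or_gt_of_ne hNw with h | h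
    · refine ⟨(-v₁, -v₂), -a, -b, by simpa using hab, ?_, ?_⟩
      · rw [normalForm_apply]; push_cast; linarith
      · rw [normalForm_apply] at h ⊢
        push_cast at h ⊢
        linarith
    · exact ⟨(v₁, v₂), a, b, hab, hN1, h⟩
  refine ⟨v, ⟨a, b, hab⟩, hNv, ?_⟩
  let φ : Lattice →+ ℤ × ℤ :=
    { toFun := fun u => (a * u.1 + b * u.2, v.1 * u.2 - v.2 * u.1)
      map_zero' := by simp
      map_add' := fun u u' => by ext <;> simp <;> ring }
  have hφ : ∀ u, φ u = (a * u.1 + b * u.2, v.1 * u.2 - v.2 * u.1) := fun _ => rfl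
  let ψ : ℤ × ℤ → Lattice := fun p => (p.1 * v.1 + p.2 * (-b), p.1 * v.2 + p.2 * a)
  have hψφ : ∀ u, ψ (φ u) = u := fun u => by
    refine Prod.ext ?_ ?_
    · simp only [ψ, hφ]; linear_combination u.1 * hab
    · simp only [ψ, hφ]; linear_combination u.2 * hab
  have hφψ : ∀ p, φ (ψ p) = p := fun p => by
    refine Prod.ext ?_ ?_
    · simp only [ψ, hφ]; linear_combination p.1 * hab
    · simp only [ψ, hφ]; linear_combination p.2 * hab
  have hact : ∀ {k : Type} [CommRing k] (F : AddMonoidAlgebra k Lattice),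
      act F (fun u => (e u : k)) = 0 →
      act (AddMonoidAlgebra.mapDomain φ F) (fun p => (e (ψ p) : k)) = 0 := by
    intro k _ F hF
    funext p
    rw [← hφψ p, act_mapDomain]
    simp only [hψφ, hF]
    rfl
  have hinj : Function.Injective φ := fun u u' h => by rw [← hψφ u, h, hψφ]
  obtain ⟨ω, hω, hroot⟩ := exists_common_zero_of_half_plane
    (f := AddMonoidAlgebra.mapDomain φ f) (e := fun p => e (ψ p)) (B := B)
    (fun h => hf (AddMonoidAlgebra.mapDomain_injective hinj (by rw [h]; simp)))
    (fun p => hB _) (by simpa using hact f (by simpa using hfe))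
    (fun p q hq => hneg _ (by
      have h1 : N (ψ (p, q)) = q * N (-b, a) + p * N v := by
        simp only [N, ψ, normalForm_apply]; push_cast; ring
      rw [h1, hNv, mul_zero, add_zero]
      exact mul_neg_of_neg_of_pos (by exact_mod_cast hq) hNw))
    (by
      have h1 : ψ (0, 0) = 0 := by simp [ψ]
      rwa [h1])
  refine ⟨ω, hω, fun F hF x y hx hy hxy => ?_⟩
  -- The monomials with exponents `v` and `(-b, a)` are the new variables; at `(x, y)` they take the
  -- values `ω` and `x ^ (-b) * y ^ a`.
  have h1 := hroot _ (hact F (he.act_eq_zero hF)) (x ^ (-b) * y ^ a)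
  rw [AddMonoidAlgebra.coeff_mapDomain, Finsupp.sum_mapDomain_index
    (by simp) (by intro s a b; ring)] at h1
  rw [← h1]
  refine Finset.sum_congr rfl fun s _ => ?_
  change F.coeff s * _ = F.coeff s * _
  congr 1
  have hs := hψφ s
  generalize φ s = p at hs ⊢
  rw [← hs, ← hxy, mul_zpow, mul_zpow, ← zpow_mul, ← zpow_mul, ← zpow_mul, ← zpow_mul]
  simp only [ψ]
  rw [zpow_add₀ hx, zpow_add₀ hy, mul_comm p.1, mul_comm p.2, mul_comm p.1, mul_comm p.2]
  ring

end ChangeOfCoordinates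

/-! ### Evaluation and vanishing criteria -/

section Evaluation

/-- Evaluation of a Laurent polynomial in one variable. -/
noncomputable def evalOne (x : ℂˣ) : AddMonoidAlgebra ℂ ℤ →ₐ[ℂ] ℂ :=
  AddMonoidAlgebra.lift ℂ ℂ ℤ
    { toFun := fun s => (x : ℂ) ^ s.toAdd
      map_one' := by simp
      map_mul' := fun s t => by simp [zpow_add₀ x.ne_zero] }

/-- Evaluation of a Laurent polynomial in two variables. -/
noncomputable def evalTwo (x y : ℂˣ) : AddMonoidAlgebra ℂ Lattice →ₐ[ℂ] ℂ :=
  AddMonoidAlgebra.lift ℂ ℂ Lattice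
    { toFun := fun s => (x : ℂ) ^ s.toAdd.1 * (y : ℂ) ^ s.toAdd.2
      map_one' := by simp
      map_mul' := fun s t => by
        simp [zpow_add₀ x.ne_zero, zpow_add₀ y.ne_zero]; ring }

theorem evalOne_apply (x : ℂˣ) (g : AddMonoidAlgebra ℂ ℤ) :
    evalOne x g = g.coeff.sum fun s c => c * (x : ℂ) ^ s := by
  rw [evalOne, AddMonoidAlgebra.lift_apply]; rfl

theorem evalTwo_apply (x y : ℂˣ) (F : AddMonoidAlgebra ℂ Lattice) :
    evalTwo x y F = F.coeff.sum fun s c => c * ((x : ℂ) ^ s.1 * (y : ℂ) ^ s.2) := by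
  rw [evalTwo, AddMonoidAlgebra.lift_apply]; rfl

theorem evalOne_single (x : ℂˣ) (s : ℤ) (c : ℂ) :
    evalOne x (AddMonoidAlgebra.single s c) = c * (x : ℂ) ^ s := by
  rw [evalOne, AddMonoidAlgebra.lift_single]; rfl

theorem evalTwo_single (x y : ℂˣ) (s : Lattice) (c : ℂ) :
    evalTwo x y (AddMonoidAlgebra.single s c) = c * ((x : ℂ) ^ s.1 * (y : ℂ) ^ s.2) := by
  rw [evalTwo, AddMonoidAlgebra.lift_single]; rfl

theorem evalTwo_eq_sum_rows (x y : ℂˣ) (F : AddMonoidAlgebra ℂ Lattice) {T : Finset ℤ}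
    (hT : ∀ s ∈ F.coeff.support, s.2 ∈ T) :
    evalTwo x y F = ∑ b ∈ T, (y : ℂ) ^ b * evalOne x (row F b) := by
  rw [evalTwo_apply, sum_eq_sum_rows F (fun a => (x : ℂ) ^ a) (fun b => (y : ℂ) ^ b) hT]
  simp only [evalOne_apply]

/-- Up to a power of X this is a polynomial with infinitely many zeros. Points with |x| > 1 must
suffice, because that is where nonparallel curves are disjoint. -/
theorem eq_zero_of_evalOne_eq_zero {g : AddMonoidAlgebra ℂ ℤ}
    (h : ∀ x : ℂˣ, 1 < ‖(x : ℂ)‖ → evalOne x g = 0) : g = 0 := by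
  by_contra hg
  have hne : g.coeff.support.Nonempty := by
    rw [Finsupp.support_nonempty_iff]; simpa using hg
  obtain ⟨lo, hlo, hmin⟩ := Finset.exists_min_image g.coeff.support id hne
  simp only [id] at hmin
  set P : Polynomial ℂ := ∑ s ∈ g.coeff.support, Polynomial.monomial (s - lo).toNat (g.coeff s)
  have hP : P = 0 := by
    refine Polynomial.eq_zero_of_infinite_isRoot P (Set.Infinite.mono
      (s := (fun t : ℝ => (t : ℂ)) '' Set.Ioi 1) ?_ ?_)
    · rintro _ ⟨t, ht, rfl⟩
      have ht0 : (t : ℂ) ≠ 0 := by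
        have : t ≠ 0 := (zero_lt_one.trans ht).ne'
        exact_mod_cast this
      have h1 := h (Units.mk0 (t : ℂ) ht0) (by
        simp only [Units.val_mk0, Complex.norm_real, Real.norm_eq_abs]
        exact lt_of_lt_of_le ht (le_abs_self t))
      rw [evalOne_apply, Finsupp.sum, Units.val_mk0] at h1
      change Polynomial.eval (t : ℂ) P = 0
      have h2 := congrArg (· * (t : ℂ) ^ (-lo)) h1
      simp only [zero_mul, Finset.sum_mul] at h2
      rw [Polynomial.eval_finsetSum, ← h2]
      refine Finset.sum_congr rfl fun s hs => ?_
      rw [Polynomial.eval_monomial, mul_assoc, ← zpow_add₀ ht0, ← zpow_natCast]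
      congr 2
      have := hmin s hs
      omega
    · refine Set.Infinite.image (fun a _ b _ hab => ?_) (Set.Ioi_infinite 1)
      exact_mod_cast hab
  have h1 : P.coeff 0 = g.coeff lo := by
    rw [Polynomial.finsetSum_coeff, Finset.sum_eq_single lo]
    · simp
    · intro s hs hne
      rw [Polynomial.coeff_monomial, if_neg]
      have := hmin s hs
      omega
    · intro h; exact absurd hlo h
  rw [hP] at h1
  simp at hlo h1
  exact hlo h1.symm

theorem eq_zero_of_rows_eq_zero {F : AddMonoidAlgebra ℂ Lattice} (h : ∀ b, row F b = 0) :
    F = 0 := by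
  refine AddMonoidAlgebra.ext (Finsupp.ext fun s => ?_)
  have : (row F s.2).coeff s.1 = 0 := by rw [h]; rfl
  rwa [coeff_row] at this

/-- A Laurent polynomial on three rows with three zeros on each vertical line is zero. -/
theorem eq_zero_of_three_zeros {F : AddMonoidAlgebra ℂ Lattice}
    (hF : ∀ s ∈ F.coeff.support, s.2 ∈ ({0, 1, 2} : Finset ℤ))
    (h : ∀ x : ℂˣ, 1 < ‖(x : ℂ)‖ → ∃ y₁ y₂ y₃ : ℂˣ, y₁ ≠ y₂ ∧ y₁ ≠ y₃ ∧ y₂ ≠ y₃ ∧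
      evalTwo x y₁ F = 0 ∧ evalTwo x y₂ F = 0 ∧ evalTwo x y₃ F = 0) : F = 0 := by
  have key : ∀ x : ℂˣ, 1 < ‖(x : ℂ)‖ → evalOne x (row F 0) = 0 ∧ evalOne x (row F 1) = 0 ∧
      evalOne x (row F 2) = 0 := by
    intro x hx
    obtain ⟨y₁, y₂, y₃, h12, h13, h23, e1, e2, e3⟩ := h x hx
    rw [evalTwo_eq_sum_rows x _ F hF] at e1 e2 e3
    simp only [Finset.sum_insert, Finset.mem_insert, Finset.mem_singleton, Finset.sum_singleton,
      zero_ne_one, OfNat.zero_ne_ofNat, OfNat.one_ne_ofNat, or_self, not_false_eq_true,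
      zpow_ofNat] at e1 e2 e3
    generalize evalOne x (row F 0) = a at *
    generalize evalOne x (row F 1) = b at *
    generalize evalOne x (row F 2) = c at *
    have d12 : (y₁ : ℂ) - y₂ ≠ 0 := sub_ne_zero.mpr fun h => h12 (Units.ext h)
    have d13 : (y₁ : ℂ) - y₃ ≠ 0 := sub_ne_zero.mpr fun h => h13 (Units.ext h)
    have d23 : (y₂ : ℂ) - y₃ ≠ 0 := sub_ne_zero.mpr fun h => h23 (Units.ext h)
    have f12 : b + (y₁ + y₂) * c = 0 :=
      (mul_eq_zero.mp (by linear_combination e1 - e2 :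
        ((y₁ : ℂ) - y₂) * (b + (y₁ + y₂) * c) = 0)).resolve_left d12
    have f13 : b + (y₁ + y₃) * c = 0 :=
      (mul_eq_zero.mp (by linear_combination e1 - e3 :
        ((y₁ : ℂ) - y₃) * (b + (y₁ + y₃) * c) = 0)).resolve_left d13
    have hc : c = 0 :=
      (mul_eq_zero.mp (by linear_combination f12 - f13 :
        ((y₂ : ℂ) - y₃) * c = 0)).resolve_left d23
    have hb : b = 0 := by linear_combination f12 - (y₁ + y₂) * hc
    exact ⟨by linear_combination e1 - y₁ * hb - y₁ ^ 2 * hc, hb, hc⟩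
  refine eq_zero_of_rows_eq_zero fun b => ?_
  by_cases hb : b ∈ ({0, 1, 2} : Finset ℤ)
  · simp only [Finset.mem_insert, Finset.mem_singleton] at hb
    rcases hb with rfl | rfl | rfl
    · exact eq_zero_of_evalOne_eq_zero fun x hx => (key x hx).1
    · exact eq_zero_of_evalOne_eq_zero fun x hx => (key x hx).2.1
    · exact eq_zero_of_evalOne_eq_zero fun x hx => (key x hx).2.2
  · refine AddMonoidAlgebra.ext (Finsupp.ext fun a => ?_)
    by_contra hne
    exact hb (hF (a, b) (by simpa using hne))

end Evaluation

/-! ### Curves on which all annihilators vanish -/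

section Curves

/-- All annihilators of `ξ` vanish on the curve `x ^ v.1 * y ^ v.2 = ω`. -/
def VanishOnCurve (ξ : Lattice → ℂ) (v : Lattice) (ω : ℂ) : Prop :=
  ∀ F : AddMonoidAlgebra ℂ Lattice, act F ξ = 0 → ∀ x y : ℂˣ,
    (x : ℂ) ^ v.1 * (y : ℂ) ^ v.2 = ω → evalTwo x y F = 0

theorem VanishOnCurve.neg {ξ : Lattice → ℂ} {v : Lattice} {ω : ℂ} (h : VanishOnCurve ξ v ω) :
    VanishOnCurve ξ (-v) ω⁻¹ := by
  intro F hF x y hxy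
  refine h F hF x y ?_
  rw [← inv_inj, ← hxy, mul_inv]
  simp [zpow_neg]

/-- (X - 1)F is an annihilator, and x - 1 ≠ 0 for |x| > 1. -/
theorem VanishOnCurve.eval_eq_zero_of_const {ξ : Lattice → ℂ} {v : Lattice} {ω : ℂ}
    (h : VanishOnCurve ξ v ω) {F : AddMonoidAlgebra ℂ Lattice} {c : ℂ}
    (hF : act F ξ = fun _ => c) {x y : ℂˣ} (hx : 1 < ‖(x : ℂ)‖)
    (hxy : (x : ℂ) ^ v.1 * (y : ℂ) ^ v.2 = ω) : evalTwo x y F = 0 := by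
  have h1 := h ((AddMonoidAlgebra.single (1, 0) 1 - 1) * F)
    (by rw [act_mul, hF, act_single_sub_one_const]) x y hxy
  rw [map_mul, map_sub, map_one, evalTwo_single] at h1
  refine (mul_eq_zero.mp h1).resolve_left ?_
  simp only [zpow_one, zpow_zero, mul_one, one_mul]
  intro h2
  rw [sub_eq_zero] at h2
  rw [h2] at hx
  simp at hx

theorem exists_point_on_curve {v : Lattice} (hv : 0 < v.2) {ω : ℂ} (hω : ‖ω‖ = 1) (x : ℂˣ) :
    ∃ y : ℂˣ, (x : ℂ) ^ v.1 * (y : ℂ) ^ v.2 = ω := by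
  have hω0 : ω ≠ 0 := by rintro rfl; simp at hω
  obtain ⟨z, hz⟩ := IsAlgClosed.exists_pow_nat_eq (ω * (x : ℂ) ^ (-v.1)) (n := v.2.toNat) (by omega)
  have hx : (x : ℂ) ^ v.1 ≠ 0 := zpow_ne_zero _ x.ne_zero
  have hz0 : z ≠ 0 := by
    rintro rfl
    rw [zero_pow (by omega), zpow_neg] at hz
    exact (mul_ne_zero hω0 (inv_ne_zero hx)) hz.symm
  refine ⟨Units.mk0 z hz0, ?_⟩
  rw [Units.val_mk0]
  have : z ^ v.2 = z ^ v.2.toNat := by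
    rw [← zpow_natCast]
    congr 1
    omega
  rw [this, hz, zpow_neg]
  field_simp

/-- Logarithms of moduli turn the two equations into a homogeneous linear system for (log|x|,
log|y|). Since log|x| > 0, its determinant vanishes. -/
theorem parallel_of_common_point {v w : Lattice} {ω ω' : ℂ} (hω : ‖ω‖ = 1) (hω' : ‖ω'‖ = 1)
    {x y : ℂˣ} (hx : 1 < ‖(x : ℂ)‖) (h : (x : ℂ) ^ v.1 * (y : ℂ) ^ v.2 = ω)
    (h' : (x : ℂ) ^ w.1 * (y : ℂ) ^ w.2 = ω') : v.1 * w.2 = v.2 * w.1 := by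
  have hlog : ∀ {v : Lattice} {ω : ℂ}, ‖ω‖ = 1 → (x : ℂ) ^ v.1 * (y : ℂ) ^ v.2 = ω →
      v.1 * Real.log ‖(x : ℂ)‖ + v.2 * Real.log ‖(y : ℂ)‖ = 0 := by
    intro v ω hω h
    rw [← Real.log_zpow, ← Real.log_zpow, ← Real.log_mul, ← norm_zpow, ← norm_zpow, ← norm_mul, h,
      hω, Real.log_one]
    · exact zpow_ne_zero _ (norm_ne_zero_iff.mpr x.ne_zero)
    · exact zpow_ne_zero _ (norm_ne_zero_iff.mpr y.ne_zero)
  have h1 := hlog hω h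
  have h2 := hlog hω' h'
  have h3 := (Real.log_pos hx).ne'
  have h4 : ((v.1 * w.2 - v.2 * w.1 : ℤ) : ℝ) * Real.log ‖(x : ℂ)‖ = 0 := by
    push_cast
    linear_combination (w.2 : ℝ) * h1 - v.2 * h2
  have h5 := (mul_eq_zero.mp h4).resolve_right h3
  have h6 : v.1 * w.2 - v.2 * w.1 = 0 := by exact_mod_cast h5
  omega

theorem exists_two_points_on_curve {v : Lattice} (hv : 2 ≤ v.2) {ω : ℂ} (hω : ‖ω‖ = 1) (x : ℂˣ) :
    ∃ y y' : ℂˣ, y ≠ y' ∧ (x : ℂ) ^ v.1 * (y : ℂ) ^ v.2 = ω ∧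
      (x : ℂ) ^ v.1 * (y' : ℂ) ^ v.2 = ω := by
  obtain ⟨y, hy⟩ := exists_point_on_curve (zero_lt_two.trans_le hv) hω x
  have hprim := Complex.isPrimitiveRoot_exp v.2.toNat (by omega)
  set ζ := Complex.exp (2 * Real.pi * Complex.I / v.2.toNat)
  have hζ0 : ζ ≠ 0 := Complex.exp_ne_zero _
  have hζ1 : ζ ≠ 1 := hprim.ne_one (by omega)
  have hζ : ζ ^ v.2 = 1 := by
    have h1 : ζ ^ v.2 = ζ ^ v.2.toNat := by
      rw [← zpow_natCast]
      congr 1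
      omega
    rw [h1, hprim.pow_eq_one]
  refine ⟨y, y * Units.mk0 ζ hζ0, ?_, hy, ?_⟩
  · intro h
    have h1 : Units.mk0 ζ hζ0 = 1 := by simpa using h.symm
    exact hζ1 (by simpa using congrArg Units.val h1)
  · rw [Units.val_mul, Units.val_mk0, mul_zpow, hζ, mul_one, hy]

/-- Two nonparallel curves that rise by one row each, from three pairwise nonparallel ones. -/
theorem exists_two_graphs {ξ : Lattice → ℂ} {F : AddMonoidAlgebra ℂ Lattice} (hF0 : F ≠ 0)
    (hF : ∀ s ∈ F.coeff.support, s.2 ∈ ({0, 1, 2} : Finset ℤ)) {c : ℂ}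
    (hFξ : act F ξ = fun _ => c) {v : Fin 3 → Lattice} {ω : Fin 3 → ℂ} (hω : ∀ i, ‖ω i‖ = 1)
    (hv : ∀ i, VanishOnCurve ξ (v i) (ω i))
    (hpar : ∀ i j, i ≠ j → (v i).1 * (v j).2 ≠ (v i).2 * (v j).1) :
    ∃ (p q : ℤ) (α β : ℂ), p < q ∧ ‖α‖ = 1 ∧ ‖β‖ = 1 ∧
      VanishOnCurve ξ (-p, 1) α ∧ VanishOnCurve ξ (-q, 1) β := by
  wlog hpos : ∀ i, 0 ≤ (v i).2 generalizing v ω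
  · let v' : Fin 3 → Lattice := fun i => if 0 ≤ (v i).2 then v i else -v i
    let ω' : Fin 3 → ℂ := fun i => if 0 ≤ (v i).2 then ω i else (ω i)⁻¹
    refine this (v := v') (ω := ω') ?_ ?_ ?_ ?_
    · intro i
      simp only [ω']
      split_ifs <;> simp [hω]
    · intro i
      simp only [ω', v']
      split_ifs
      · exact hv i
      · exact (hv i).neg
    · intro i j hij
      have := hpar i j hij
      simp only [v']
      split_ifs <;> simpa using this
    · intro i
      simp only [v']
      split_ifs with h
      · exact h
      · simp only [Prod.snd_neg]; omega
  have hev : ∀ i (x y : ℂˣ), 1 < ‖(x : ℂ)‖ → (x : ℂ) ^ (v i).1 * (y : ℂ) ^ (v i).2 = ω i →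
      evalTwo x y F = 0 := fun i x y hx hxy => (hv i).eval_eq_zero_of_const hFξ hx hxy
  have hne : ∀ i j, i ≠ j → ∀ (x y y' : ℂˣ), 1 < ‖(x : ℂ)‖ →
      (x : ℂ) ^ (v i).1 * (y : ℂ) ^ (v i).2 = ω i →
      (x : ℂ) ^ (v j).1 * (y' : ℂ) ^ (v j).2 = ω j → y ≠ y' := by
    rintro i j hij x y _ hx h h' rfl
    exact hpar i j hij (parallel_of_common_point (hω i) (hω j) hx h h')
  -- If the second exponent of curve `i` were at least 2, the curve would have two points over each
  -- `x`, and curve `j` would add a third, too many zeros for degree 2 in y.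
  have hone : ∀ i j, i ≠ j → 0 < (v i).2 → 0 < (v j).2 → (v i).2 = 1 := by
    intro i j hij hi hj
    by_contra hcon
    refine hF0 (eq_zero_of_three_zeros hF fun x hx => ?_)
    obtain ⟨y₁, y₂, h12, h1, h2⟩ :=
      exists_two_points_on_curve (v := v i) (by omega) (hω i) x
    obtain ⟨y₃, h3⟩ := exists_point_on_curve hj (hω j) x
    exact ⟨y₁, y₂, y₃, h12, hne i j hij x _ _ hx h1 h3, hne i j hij x _ _ hx h2 h3,
      hev i x _ hx h1, hev i x _ hx h2, hev j x _ hx h3⟩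
  -- Among pairwise nonparallel exponents at most one has second coordinate 0.
  obtain ⟨i, j, hij, hi, hj⟩ : ∃ i j, i ≠ j ∧ 0 < (v i).2 ∧ 0 < (v j).2 := by
    by_contra! hcon
    have hz : ∀ i j, i ≠ j → (v i).2 = 0 → (v j).2 ≠ 0 := by
      intro i j hij h1 h2
      exact hpar i j hij (by rw [h1, h2]; ring)
    have a01 := hcon 0 1 (by decide)
    have a12 := hcon 1 2 (by decide)
    have a02 := hcon 0 2 (by decide)
    have b01 := hz 0 1 (by decide)
    have b12 := hz 1 2 (by decide)
    have b02 := hz 0 2 (by decide)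
    have c0 := hpos 0
    have c1 := hpos 1
    have c2 := hpos 2
    omega
  wlog hlt : (v j).1 < (v i).1 generalizing i j
  · have h1 := hpar i j hij
    rw [hone i j hij hi hj, hone j i hij.symm hj hi] at h1
    exact this j i hij.symm hj hi (by omega)
  refine ⟨-(v i).1, -(v j).1, ω i, ω j, by omega, hω i, hω j, ?_, ?_⟩
  · have : (- -(v i).1, 1) = v i := Prod.ext (neg_neg _) (hone i j hij hi hj).symm
    rw [this]; exact hv i
  · have : (- -(v j).1, 1) = v j := Prod.ext (neg_neg _) (hone j i hij.symm hj hi).symm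
    rw [this]; exact hv j

end Curves

/-! ### Nonexpansive lines and their curves -/

section Lines

variable {A : Type*} {η : Lattice → A}

theorem toPlane_apply_zero (u : Lattice) : toPlane u 0 = u.1 := rfl

theorem toPlane_apply_one (u : Lattice) : toPlane u 1 = u.2 := rfl

theorem exists_spanning_vector {ℓ : AffineSubspace ℝ Plane} (hℓ : Module.finrank ℝ ℓ.direction = 1)
    (h0 : (0 : Plane) ∈ ℓ) :
    ∃ d : Plane, d ≠ 0 ∧ ∀ p, p ∈ ℓ ↔ ∃ t : ℝ, t • d = p := by
  have hmem : ∀ p, p ∈ ℓ.direction ↔ p ∈ ℓ := fun p => by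
    rw [← AffineSubspace.vsub_right_mem_direction_iff_mem h0 p]
    simp
  obtain ⟨⟨d, hd⟩, hd0, hspan⟩ := finrank_eq_one_iff'.mp hℓ
  refine ⟨d, fun h => hd0 (Subtype.ext h), fun p => ⟨fun hp => ?_, ?_⟩⟩
  · obtain ⟨t, ht⟩ := hspan ⟨p, (hmem p).mpr hp⟩
    exact ⟨t, congrArg Subtype.val ht⟩
  · rintro ⟨t, rfl⟩
    exact (hmem _).mp (ℓ.direction.smul_mem t hd)

theorem sq_add_sq_pos {d : Plane} (hd : d ≠ 0) : 0 < d 0 ^ 2 + d 1 ^ 2 := by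
  by_contra hcon
  have h0 : d 0 = 0 := by nlinarith [sq_nonneg (d 0), sq_nonneg (d 1)]
  have h1 : d 1 = 0 := by nlinarith [sq_nonneg (d 0), sq_nonneg (d 1)]
  refine hd (PiLp.ext fun i => ?_)
  fin_cases i
  · exact h0
  · exact h1

/-- The distance to the line spanned by `d`, in terms of the normal form. -/
theorem infDist_lt_of_abs_normalForm_lt {ℓ : AffineSubspace ℝ Plane} {d : Plane} (hd : d ≠ 0)
    (hℓ : ∀ p, p ∈ ℓ ↔ ∃ t : ℝ, t • d = p) {u : Lattice} {r : ℝ}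
    (hu : |normalForm (d 0, d 1) u| < r) :
    Metric.infDist (toPlane u) (ℓ : Set Plane) < r / Real.sqrt (d 0 ^ 2 + d 1 ^ 2) := by
  have hD := sq_add_sq_pos hd
  set D := d 0 ^ 2 + d 1 ^ 2 with hDdef
  set t := (u.1 * d 0 + u.2 * d 1) / D with ht
  have htD : t * D = u.1 * d 0 + u.2 * d 1 := div_mul_cancel₀ _ hD.ne'
  refine (Metric.infDist_le_dist_of_mem ((hℓ (t • d)).mpr ⟨t, rfl⟩)).trans_lt ?_
  have hr : 0 < r := (abs_nonneg _).trans_lt hu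
  rw [EuclideanSpace.dist_eq, Fin.sum_univ_two, Real.sqrt_lt' (by positivity), div_pow,
    Real.sq_sqrt hD.le, lt_div_iff₀ hD]
  simp only [Real.dist_eq, sq_abs, toPlane_apply_zero, toPlane_apply_one, PiLp.smul_apply,
    smul_eq_mul]
  have h1 : ((u.1 - t * d 0) ^ 2 + (u.2 - t * d 1) ^ 2) * D = normalForm (d 0, d 1) u ^ 2 := by
    rw [normalForm_apply]
    simp only
    have : ((u.1 - t * d 0) ^ 2 + (u.2 - t * d 1) ^ 2) * D
        = (u.1 ^ 2 + u.2 ^ 2) * D - 2 * (t * D) * (u.1 * d 0 + u.2 * d 1) + (t * D) ^ 2 := by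
      rw [hDdef]; ring
    rw [this, htD, hDdef]
    ring
  rw [h1, ← sq_abs]
  exact pow_lt_pow_left₀ hu (abs_nonneg _) two_ne_zero

theorem toPlane_mem_of_normalForm_eq_zero {ℓ : AffineSubspace ℝ Plane} {d : Plane} (hd : d ≠ 0)
    (hℓ : ∀ p, p ∈ ℓ ↔ ∃ t : ℝ, t • d = p) {v : Lattice}
    (hv : normalForm (d 0, d 1) v = 0) : toPlane v ∈ ℓ := by
  have hD := sq_add_sq_pos hd
  rw [normalForm_apply] at hv
  simp only at hv
  refine (hℓ _).mpr ⟨(v.1 * d 0 + v.2 * d 1) / (d 0 ^ 2 + d 1 ^ 2), PiLp.ext fun i => ?_⟩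
  fin_cases i
  · change (v.1 * d 0 + v.2 * d 1) / (d 0 ^ 2 + d 1 ^ 2) * d 0 = v.1
    field_simp
    linear_combination d 1 * hv
  · change (v.1 * d 0 + v.2 * d 1) / (d 0 ^ 2 + d 1 ^ 2) * d 1 = v.2
    field_simp
    linear_combination - d 0 * hv

theorem eq_of_parallel {ℓ ℓ' : AffineSubspace ℝ Plane} (h1 : Module.finrank ℝ ℓ.direction = 1)
    (h1' : Module.finrank ℝ ℓ'.direction = 1) (h0 : (0 : Plane) ∈ ℓ) (h0' : (0 : Plane) ∈ ℓ')
    {v w : Lattice} (hv : IsCoprime v.1 v.2) (hw : IsCoprime w.1 w.2) (hvℓ : toPlane v ∈ ℓ)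
    (hwℓ' : toPlane w ∈ ℓ') (hpar : v.1 * w.2 = v.2 * w.1) : ℓ = ℓ' := by
  obtain ⟨d, hd, hℓ⟩ := exists_spanning_vector h1 h0
  obtain ⟨d', hd', hℓ'⟩ := exists_spanning_vector h1' h0'
  obtain ⟨a, b, hab⟩ := hv
  obtain ⟨a', b', hab'⟩ := hw
  obtain ⟨t, ht⟩ := (hℓ _).mp hvℓ
  obtain ⟨t', ht'⟩ := (hℓ' _).mp hwℓ'
  have hwv : toPlane w = ((a * w.1 + b * w.2 : ℤ) : ℝ) • toPlane v := by
    refine PiLp.ext fun i => ?_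
    fin_cases i
    · change (w.1 : ℝ) = ((a * w.1 + b * w.2 : ℤ) : ℝ) * v.1
      norm_cast
      linear_combination - w.1 * hab - b * hpar
    · change (w.2 : ℝ) = ((a * w.1 + b * w.2 : ℤ) : ℝ) * v.2
      norm_cast
      linear_combination - w.2 * hab + a * hpar
  have hw0 : toPlane w ≠ 0 := by
    intro h
    have e1 : (w.1 : ℝ) = 0 := congrFun (congrArg WithLp.ofLp h) 0
    have e2 : (w.2 : ℝ) = 0 := congrFun (congrArg WithLp.ofLp h) 1
    have e1' : w.1 = 0 := by exact_mod_cast e1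
    have e2' : w.2 = 0 := by exact_mod_cast e2
    rw [e1', e2'] at hab'
    simp at hab'
  set z := ((a * w.1 + b * w.2 : ℤ) : ℝ)
  have hz : (z * t) • d = t' • d' := by rw [mul_smul, ht, ht', hwv]
  have hzt : z * t ≠ 0 := by
    intro h
    rw [h, zero_smul, ht'] at hz
    exact hw0 hz.symm
  have ht'0 : t' ≠ 0 := by
    rintro rfl
    rw [zero_smul] at ht'
    exact hw0 ht'.symm
  refine SetLike.ext fun p => ?_
  rw [hℓ, hℓ']
  constructor
  · rintro ⟨s, rfl⟩
    refine ⟨s * (z * t)⁻¹ * t', ?_⟩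
    rw [mul_smul, ← hz, smul_smul, mul_assoc, inv_mul_cancel₀ hzt, mul_one]
  · rintro ⟨s, rfl⟩
    refine ⟨s * t'⁻¹ * (z * t), ?_⟩
    rw [mul_smul, hz, smul_smul, mul_assoc, inv_mul_cancel₀ ht'0, mul_one]

/-- A nonexpansive line is rational, and comes with a curve on which all annihilators vanish. -/
theorem IsNonexpansiveLine.exists_vanishOnCurve [Finite A] {ι : A → ℤ}
    (hι : Function.Injective ι) {ℓ : AffineSubspace ℝ Plane} (hℓ : IsNonexpansiveLine η ℓ)
    (h0 : (0 : Plane) ∈ ℓ) {f : AddMonoidAlgebra ℤ Lattice} (hf : f ≠ 0)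
    (hfη : act f (fun u => ι (η u)) = 0) :
    ∃ v : Lattice, IsCoprime v.1 v.2 ∧ toPlane v ∈ ℓ ∧ ∃ ω : ℂ, ‖ω‖ = 1 ∧
      VanishOnCurve (fun u => (ι (η u) : ℂ)) v ω := by
  obtain ⟨d, hd, hspan⟩ := exists_spanning_vector hℓ.1 h0
  set N := normalForm (d 0, d 1) with hN
  have hstep : ∀ n : ℕ, ∃ f ∈ orbitClosure η, ∃ g ∈ orbitClosure η,
      (∀ u, |N u| < (n : ℝ) + 1 → f u = g u) ∧ ∃ u, (0 < N u ∨ N u < 0) ∧ f u ≠ g u := by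
    intro n
    obtain ⟨f, hf, g, hg, hne, hag⟩ := hℓ.2 (((n : ℝ) + 1) / Real.sqrt (d 0 ^ 2 + d 1 ^ 2))
    have hag' : ∀ u, |N u| < (n : ℝ) + 1 → f u = g u := fun u hu =>
      hag u (infDist_lt_of_abs_normalForm_lt hd hspan hu)
    obtain ⟨u, hu⟩ := Function.ne_iff.mp hne
    refine ⟨f, hf, g, hg, hag', u, ?_, hu⟩
    rcases lt_trichotomy (N u) 0 with h | h | h
    · exact Or.inr h
    · exact absurd (hag' u (by rw [h, abs_zero]; positivity)) hu
    · exact Or.inl h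
  have hd2 : (d 0, d 1) ≠ (0 : ℝ × ℝ) := by
    intro h
    have := sq_add_sq_pos hd
    have h1 : d 0 = 0 := congrArg Prod.fst h
    have h2 : d 1 = 0 := congrArg Prod.snd h
    rw [h1, h2] at this
    simp at this
  have conclude : ∀ c : ℝ × ℝ, c ≠ 0 → (∀ v, normalForm c v = 0 → N v = 0) →
      (∀ n : ℕ, ∃ f ∈ orbitClosure η, ∃ g ∈ orbitClosure η,
        (∀ u, |normalForm c u| < n → f u = g u) ∧ ∃ u, 0 < normalForm c u ∧ f u ≠ g u) →
      ∃ v : Lattice, IsCoprime v.1 v.2 ∧ toPlane v ∈ ℓ ∧ ∃ ω : ℂ, ‖ω‖ = 1 ∧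
        VanishOnCurve (fun u => (ι (η u) : ℂ)) v ω := by
    intro c hc hcN h
    obtain ⟨e, he, he0, hneg⟩ := exists_isLocalDifference ι hι η (normalForm c) h
    obtain ⟨v, hcop, hNv, ω, hω, hvan⟩ :=
      exists_direction_and_common_zero hc he he0 hneg hf hfη
    refine ⟨v, hcop, toPlane_mem_of_normalForm_eq_zero hd hspan (hcN v hNv), ω, hω, ?_⟩
    intro F hF x y hxy
    rw [evalTwo_apply]
    exact hvan F hF x y x.ne_zero y.ne_zero hxy
  -- The side of disagreement may vary with the strip. If the positive side fails at some width `m`,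
  -- every wider strip has its disagreement on the negative side, and `d` is reversed.
  by_cases hall : ∀ n : ℕ, ∃ f ∈ orbitClosure η, ∃ g ∈ orbitClosure η,
      (∀ u, |N u| < n → f u = g u) ∧ ∃ u, 0 < N u ∧ f u ≠ g u
  · exact conclude _ hd2 (fun _ h => h) hall
  · rw [not_forall] at hall
    obtain ⟨m, hm⟩ := hall
    have hNneg : ∀ u, normalForm (-(d 0, d 1)) u = - N u := fun u => by
      rw [hN, normalForm_apply, normalForm_apply]
      simp only [Prod.fst_neg, Prod.snd_neg]
      ring
    refine conclude (-(d 0, d 1)) (neg_ne_zero.mpr hd2) (fun v hv => ?_) fun n => ?_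
    · rw [hNneg] at hv; linarith
    · obtain ⟨f, hf, g, hg, hag, u, hu, hne⟩ := hstep (max n m)
      have hn : ((n : ℕ) : ℝ) ≤ (max n m : ℕ) := by exact_mod_cast le_max_left n m
      have hm' : ((m : ℕ) : ℝ) ≤ (max n m : ℕ) := by exact_mod_cast le_max_right n m
      refine ⟨f, hf, g, hg, fun u hu => hag u ?_, u, ?_, hne⟩
      · rw [hNneg, abs_neg] at hu
        linarith
      · rw [hNneg]
        rcases hu with h | h
        · exact absurd ⟨f, hf, g, hg, fun u hu => hag u (by linarith), u, h, hne⟩ hm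
        · linarith

end Lines

/-! ### Graph polynomials Y - αX^p -/

section Embedding

variable {k : Type*} [CommRing k]

/-- A Laurent polynomial in `X`, as a Laurent polynomial in `X` and `Y`. -/
noncomputable def emb : AddMonoidAlgebra k ℤ →+* AddMonoidAlgebra k Lattice :=
  AddMonoidAlgebra.mapDomainRingHom k (AddMonoidHom.inl ℤ ℤ)

theorem coeff_emb (g : AddMonoidAlgebra k ℤ) :
    (emb g).coeff = g.coeff.mapDomain fun a => (a, 0) := rfl

theorem emb_single (a : ℤ) (c : k) :
    emb (AddMonoidAlgebra.single a c) = AddMonoidAlgebra.single (a, 0) c :=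
  AddMonoidAlgebra.mapDomain_single

theorem act_emb (g : AddMonoidAlgebra k ℤ) (e : Lattice → k) (x y : ℤ) :
    act (emb g) e (x, y) = act g (fun a => e (a, y)) x := by
  rw [act_apply, act_apply, coeff_emb, Finsupp.sum_mapDomain_index]
  · simp
  · simp
  · intro s a b; ring

theorem evalTwo_emb (x y : ℂˣ) (g : AddMonoidAlgebra ℂ ℤ) :
    evalTwo x y (emb g) = evalOne x g := by
  rw [evalTwo_apply, evalOne_apply, coeff_emb, Finsupp.sum_mapDomain_index]
  · simp
  · simp
  · intro s a b; ring

/-- The Laurent polynomial `Y - α X ^ p`. -/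
noncomputable def graphPoly (p : ℤ) (α : k) : AddMonoidAlgebra k Lattice :=
  AddMonoidAlgebra.single (0, 1) 1 - AddMonoidAlgebra.single (p, 0) α

theorem act_graphPoly (p : ℤ) (α : k) (e : Lattice → k) (x y : ℤ) :
    act (graphPoly p α) e (x, y) = e (x, y + 1) - α * e (x + p, y) := by
  rw [graphPoly, act_sub_left, Pi.sub_apply, act_single, act_single]
  simp

theorem evalTwo_graphPoly (x y : ℂˣ) (p : ℤ) (α : ℂ) :
    evalTwo x y (graphPoly p α) = y - α * (x : ℂ) ^ p := by
  rw [graphPoly, map_sub, evalTwo_single, evalTwo_single]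
  simp

theorem finite_range_act {G : Type*} [AddCommGroup G] (F : AddMonoidAlgebra k G) {e : G → k}
    (he : (Set.range e).Finite) : (Set.range (act F e)).Finite := by
  have h := Set.Finite.pi' (fun _ : F.coeff.support => he)
  refine (h.image fun w => ∑ s : F.coeff.support, F.coeff s * w s).subset ?_
  rintro _ ⟨u, rfl⟩
  refine ⟨fun s => e (u + s), fun s => ⟨_, rfl⟩, ?_⟩
  rw [act_apply, Finsupp.sum]
  exact Finset.sum_coe_sort F.coeff.support fun s => F.coeff s * e (u + s)

theorem finite_range_mul {ι κ : Type*} {a : ι → k} {b : κ → k} (ha : (Set.range a).Finite)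
    (hb : (Set.range b).Finite) : {z | ∃ i j, z = a i * b j}.Finite := by
  refine (ha.image2 (· * ·) hb).subset ?_
  rintro _ ⟨i, j, rfl⟩
  exact ⟨_, ⟨i, rfl⟩, _, ⟨j, rfl⟩, rfl⟩

end Embedding

/-! ### Configurations killed by a graph polynomial -/

section Homogeneous

/-- A configuration with finitely many values on which `Y - α X ^ p` is constant is, up to a
constant, annihilated by `Y - α X ^ p`. -/
theorem exists_add_const_act_graphPoly_eq_zero {p : ℤ} {α κ : ℂ} {ζ : Lattice → ℂ}
    (hfin : (Set.range ζ).Finite) (h : act (graphPoly p α) ζ = fun _ => κ) :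
    ∃ κ', act (graphPoly p α) (fun u => ζ u + κ') = 0 := by
  have h' : ∀ x y, ζ (x, y + 1) - α * ζ (x + p, y) = κ := fun x y => by
    rw [← act_graphPoly, h]
  -- For `α = 1` the values at `(-(n * p), n)` form an arithmetic progression with difference `κ`,
  -- so finiteness forces `κ = 0`. For `α ≠ 1` a constant absorbs `κ`.
  by_cases hα : α = 1
  · refine ⟨0, ?_⟩
    subst hα
    suffices hκ : κ = 0 by
      simp only [add_zero]
      rw [h, hκ]
      rfl
    by_contra hκ
    have hval : ∀ n : ℕ, ζ (-(n * p), n) = ζ (0, 0) + n * κ := by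
      intro n
      induction n with
      | zero => simp
      | succ n ih =>
        have h1 := h' (-((n + 1 : ℕ) * p)) n
        have h2 : -(((n + 1 : ℕ) : ℤ) * p) + p = -(n * p) := by push_cast; ring
        rw [h2, ih] at h1
        push_cast at h1 ⊢
        linear_combination h1
    refine Set.infinite_of_injective_forall_mem (f := fun n : ℕ => ζ (-(n * p), n)) ?_
      (fun n => Set.mem_range_self _) hfin
    intro a b hab
    simp only [hval] at hab
    have h3 : ((a : ℂ) - b) * κ = 0 := by linear_combination hab
    have h4 := (mul_eq_zero.mp h3).resolve_right hκ
    exact_mod_cast sub_eq_zero.mp h4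
  · have h1 : (1 : ℂ) - α ≠ 0 := sub_ne_zero.mpr (Ne.symm hα)
    refine ⟨-κ / (1 - α), ?_⟩
    funext u
    obtain ⟨x, y⟩ := u
    rw [act_graphPoly, Pi.zero_apply]
    have := h' x y
    field_simp
    linear_combination (1 - α) * this

theorem eq_of_act_graphPoly_eq_zero {p : ℤ} {α : ℂ} (hα : α ≠ 0) {ζ : Lattice → ℂ}
    (h : act (graphPoly p α) ζ = 0) (x y : ℤ) : ζ (x, y) = α ^ y * ζ (x + p * y, 0) := by
  have h' : ∀ x y, ζ (x, y + 1) = α * ζ (x + p, y) := fun x y => by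
    have := congrFun h (x, y)
    rw [act_graphPoly, Pi.zero_apply, sub_eq_zero] at this
    exact this
  induction y generalizing x with
  | zero => simp
  | succ n ih =>
    rw [h', ih, zpow_add_one₀ hα, ← mul_assoc, mul_comm α]
    congr 3
    ring
  | pred n ih =>
    have h1 := h' (x - p) (-(n : ℤ) - 1)
    rw [sub_add_cancel, sub_add_cancel, ih] at h1
    refine mul_left_cancel₀ hα ?_
    rw [← h1, ← mul_assoc, ← zpow_one_add₀ hα]
    have e1 : 1 + (-(n : ℤ) - 1) = -n := by ring
    have e2 : x + p * (-(n : ℤ) - 1) = x - p + p * -(n : ℤ) := by ring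
    rw [e1, e2]

/-- A twisted Leibniz rule: since ζ(x, y+1) = αζ(x+p, y), one factor α is spent on ζ and the other
leaves Y - αX^p acting on θ. -/
theorem act_graphPoly_sq_mul {p : ℤ} {α : ℂ} {ζ : Lattice → ℂ}
    (h : act (graphPoly p α) ζ = 0) (θ : Lattice → ℂ) (x y : ℤ) :
    act (graphPoly p (α ^ 2)) (fun u => ζ u * θ u) (x, y)
      = α * ζ (x + p, y) * act (graphPoly p α) θ (x, y) := by
  have := congrFun h (x, y)
  rw [act_graphPoly, Pi.zero_apply] at this
  rw [act_graphPoly, act_graphPoly]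
  linear_combination θ (x, y + 1) * this

/-- The product of a configuration along `Y = α X ^ p` with one along `Y = β X ^ q`, acted on by
the two graph polynomials. -/
theorem act_graphPoly_graphPoly_mul {p q t : ℤ} {α β : ℂ} (hα : α ≠ 0) (hβ : β ≠ 0)
    {ζ ζ' : Lattice → ℂ} (h : act (graphPoly p α) ζ = 0) (h' : act (graphPoly q β) ζ' = 0)
    (x y : ℤ) :
    act (graphPoly q β) (act (graphPoly p α) fun u => ζ (u + (p, 0)) * ζ' (u + (t, 1))) (x, y)
      = β * (α * β) ^ (y + 1)
        * (α * ζ (x + 2 * p + p * y + p, 0) - ζ (x + 2 * p + p * y + q, 0))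
        * (β * ζ' (x + t + 2 * q + q * y + q, 0) - ζ' (x + t + 2 * q + q * y + p, 0)) := by
  simp only [act_graphPoly, Prod.mk_add_mk, add_zero]
  -- Each factor is determined by its row 0. Rewritten there, the four terms involve two values of ζ
  -- and two of ζ', and they factor.
  rw [eq_of_act_graphPoly_eq_zero hα h _ (y + 1 + 1), eq_of_act_graphPoly_eq_zero hα h _ (y + 1),
    eq_of_act_graphPoly_eq_zero hα h _ (y + 1), eq_of_act_graphPoly_eq_zero hα h _ y,
    eq_of_act_graphPoly_eq_zero hβ h' _ (y + 1 + 1 + 1),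
    eq_of_act_graphPoly_eq_zero hβ h' _ (y + 1 + 1),
    eq_of_act_graphPoly_eq_zero hβ h' _ (y + 1 + 1), eq_of_act_graphPoly_eq_zero hβ h' _ (y + 1)]
  simp only [zpow_add_one₀ hα, zpow_add_one₀ hβ, mul_zpow]
  have a1 : x + p + p * (y + 1 + 1) = x + 2 * p + p * y + p := by ring
  have a2 : x + p + p + p * (y + 1) = x + 2 * p + p * y + p := by ring
  have a3 : x + q + p + p * (y + 1) = x + 2 * p + p * y + q := by ring
  have a4 : x + q + p + p + p * y = x + 2 * p + p * y + q := by ring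
  have b1 : x + t + q * (y + 1 + 1 + 1) = x + t + 2 * q + q * y + q := by ring
  have b2 : x + p + t + q * (y + 1 + 1) = x + t + 2 * q + q * y + p := by ring
  have b3 : x + q + t + q * (y + 1 + 1) = x + t + 2 * q + q * y + q := by ring
  have b4 : x + q + p + t + q * (y + 1) = x + t + 2 * q + q * y + p := by ring
  rw [a1, a2, a3, a4, b1, b2, b3, b4]
  ring

end Homogeneous

/-! ### Periodicity and the core contradiction -/

section Periodicity

/-- If all products `(α φ(i+p) - φ(i+q)) (β ψ(j+q) - ψ(j+p))` are invariant under a simultaneous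
translation of `i` and `j`, then `φ` or `ψ` is periodic. -/
theorem periodic_or_periodic {p q : ℤ} (hpq : p < q) {α β : ℂ}
    {φ ψ : ℤ → ℂ} (hφ : (Set.range φ).Finite) (hψ : (Set.range ψ).Finite)
    {K : ℕ} (hK : 0 < K)
    (h : ∀ i j : ℤ, (α * φ (i + K + p) - φ (i + K + q)) * (β * ψ (j + K + q) - ψ (j + K + p))
      = (α * φ (i + p) - φ (i + q)) * (β * ψ (j + q) - ψ (j + p))) :
    (∃ M : ℕ, 0 < M ∧ ∀ i, φ (i + M) = φ i) ∨ ∃ M : ℕ, 0 < M ∧ ∀ i, ψ (i + M) = ψ i := by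
  have hdiff : ∀ {γ δ : ℂ} {a b : ℤ} {χ : ℤ → ℂ} (i : ℤ),
      act (AddMonoidAlgebra.single a γ - AddMonoidAlgebra.single b δ) χ i
        = γ * χ (i + a) - δ * χ (i + b) := by
    intro γ δ a b χ i
    rw [act_sub_left, Pi.sub_apply, act_single, act_single]
  have hne : ∀ {γ δ : ℂ} {a b : ℤ}, a ≠ b → δ ≠ 0 →
      (AddMonoidAlgebra.single a γ - AddMonoidAlgebra.single b δ : AddMonoidAlgebra ℂ ℤ) ≠ 0 := by
    intro γ δ a b hab hδ h0
    have h1 := congrArg (fun g : AddMonoidAlgebra ℂ ℤ => g.coeff b) h0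
    simp only [AddMonoidAlgebra.coeff_sub, AddMonoidAlgebra.coeff_single, Finsupp.sub_apply,
      Finsupp.single_apply, if_neg hab, AddMonoidAlgebra.coeff_zero, Finsupp.zero_apply, if_true,
      zero_sub, neg_eq_zero] at h1
    exact hδ h1
  -- Either the ψ-factor vanishes identically, which is a recurrence for `ψ`, or a `j` where it is
  -- nonzero turns the hypothesis into a nontrivial recurrence for `φ`.
  by_cases hz : ∀ j, β * ψ (j + q) - ψ (j + p) = 0
  · right
    obtain ⟨M, hM, hper⟩ := exists_common_period (hne (γ := β) hpq.ne' one_ne_zero) hψ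
    refine ⟨M, hM, hper ψ (fun n => ⟨n, rfl⟩) ?_⟩
    funext j
    rw [hdiff, one_mul, hz, Pi.zero_apply]
  · left
    rw [not_forall] at hz
    obtain ⟨j, hj⟩ := hz
    have hK0 : (K : ℤ) ≠ 0 := by exact_mod_cast hK.ne'
    set γ := β * ψ (j + K + q) - ψ (j + K + p)
    set δ := β * ψ (j + q) - ψ (j + p)
    obtain ⟨M, hM, hper⟩ := exists_common_period
      (mul_ne_zero (hne (γ := γ) hK0 hj) (hne (γ := α) hpq.ne one_ne_zero)) hφ
    refine ⟨M, hM, hper φ (fun n => ⟨n, rfl⟩) ?_⟩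
    funext i
    rw [act_mul, hdiff, hdiff, hdiff, Pi.zero_apply, add_zero]
    linear_combination h i j

variable {θ : Lattice → ℂ}

/-- A nonzero `h(X)` cannot make `h(X) (Y - β X ^ q) θ` horizontally periodic if all annihilators
vanish on `Y = α X ^ p`. -/
theorem not_horizontally_periodic {p q : ℤ} (hpq : p ≠ q) {α β : ℂ} (hα : ‖α‖ = 1) (hβ : ‖β‖ = 1)
    (hvan : VanishOnCurve θ (-p, 1) α) {h : AddMonoidAlgebra ℂ ℤ} (hh : h ≠ 0) {M : ℕ}
    (hM : 0 < M)
    (hper : ∀ u, act (emb h * graphPoly q β) θ (u + ((M : ℤ), 0))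
      = act (emb h * graphPoly q β) θ u) : False := by
  have hα0 : α ≠ 0 := by rintro rfl; simp at hα
  refine hh (eq_zero_of_evalOne_eq_zero fun x hx => ?_)
  -- This annihilator (X^M - 1)h(X)(Y - βX^q) vanishes on y = αx^p. For |x| > 1 neither x^M - 1 nor
  -- αx^p - βx^q is zero, so h(x) = 0.
  have hann : act ((AddMonoidAlgebra.single ((M : ℤ), 0) 1 - 1) * (emb h * graphPoly q β)) θ = 0 := by
    rw [act_mul]
    funext u
    rw [act_sub_left, map_one, Pi.sub_apply, act_single, one_mul, hper]
    simp
  have hxp : (x : ℂ) ^ p ≠ 0 := zpow_ne_zero _ x.ne_zero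
  have hxy : (x : ℂ) ^ (-p) * (α * (x : ℂ) ^ p) ^ (1 : ℤ) = α := by
    rw [zpow_neg, zpow_one]; field_simp
  have h1 := hvan _ hann x (Units.mk0 (α * (x : ℂ) ^ p) (mul_ne_zero hα0 hxp)) hxy
  rw [map_mul, map_mul, map_sub, map_one, evalTwo_single, evalTwo_graphPoly, evalTwo_emb,
    Units.val_mk0] at h1
  simp only [zpow_natCast, zpow_zero, mul_one, one_mul] at h1
  rcases mul_eq_zero.mp h1 with h2 | h2
  · exfalso
    have h3 : ‖(x : ℂ)‖ ^ M = 1 := by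
      rw [← norm_pow, sub_eq_zero.mp h2, norm_one]
    exact (one_lt_pow₀ hx hM.ne').ne' h3
  · rcases mul_eq_zero.mp h2 with h3 | h3
    · exact h3
    · exfalso
      have h4 : (x : ℂ) ^ (-q) * ((Units.mk0 (α * (x : ℂ) ^ p) (mul_ne_zero hα0 hxp) : ℂˣ) : ℂ) ^ (1 : ℤ)
          = β := by
        have hxq : (x : ℂ) ^ q ≠ 0 := zpow_ne_zero _ x.ne_zero
        rw [Units.val_mk0, sub_eq_zero.mp h3, zpow_neg, zpow_one]
        field_simp
      have h5 := parallel_of_common_point (v := (-p, 1)) (w := (-q, 1)) hα hβ hx hxy h4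
      simp at h5
      exact hpq h5

/-- The core incompatibility: products of two transversal differences of `θ` cannot satisfy linear
relations with `θ` for all relative positions. -/
theorem false_of_product_relations {p q : ℤ} (hpq : p < q) {α β : ℂ} (hα : ‖α‖ = 1)
    (hβ : ‖β‖ = 1) (hθ : (Set.range θ).Finite) (hvα : VanishOnCurve θ (-p, 1) α)
    (hvβ : VanishOnCurve θ (-q, 1) β) {h : AddMonoidAlgebra ℂ ℤ} (hh : h ≠ 0) {κ : ℂ}
    (hann : act (emb h * (graphPoly p α * graphPoly q β)) θ = fun _ => κ)
    (hrel : ∀ t, p ≤ t → t ≤ q → ∀ κ' : ℂ, ∃ (r : AddMonoidAlgebra ℂ ℤ)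
      (F : AddMonoidAlgebra ℂ Lattice) (c : ℂ), r ≠ 0 ∧
      act F θ + act (emb r) (fun u => (act (emb h * graphPoly q β) θ u + κ')
        * act (emb h) θ (u + (t, 1))) = fun _ => c) : False := by
  have hα0 : α ≠ 0 := by rintro rfl; simp at hα
  have hβ0 : β ≠ 0 := by rintro rfl; simp at hβ
  obtain ⟨κ₂, hκ₂⟩ := exists_add_const_act_graphPoly_eq_zero (p := p) (α := α)
    (finite_range_act (emb h * graphPoly q β) hθ) (κ := κ) (by
      rw [← hann, ← act_mul]; congr 2; ring)
  obtain ⟨κ₃, hκ₃⟩ := exists_add_const_act_graphPoly_eq_zero (p := q) (α := β)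
    (finite_range_act (emb h * graphPoly p α) hθ) (κ := κ) (by
      rw [← hann, ← act_mul]; congr 2; ring)
  set ζ : Lattice → ℂ := fun u => act (emb h * graphPoly q β) θ u + κ₂ with hζ
  set ζ' : Lattice → ℂ := fun u => act (emb h * graphPoly p α) θ u + κ₃ with hζ'
  have hζfin : (Set.range ζ).Finite := by
    refine ((finite_range_act (emb h * graphPoly q β) hθ).image (· + κ₂)).subset ?_
    rintro _ ⟨u, rfl⟩
    exact ⟨_, ⟨u, rfl⟩, rfl⟩
  have hζ'fin : (Set.range ζ').Finite := by
    refine ((finite_range_act (emb h * graphPoly p α) hθ).image (· + κ₃)).subset ?_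
    rintro _ ⟨u, rfl⟩
    exact ⟨_, ⟨u, rfl⟩, rfl⟩
  set φ : ℤ → ℂ := fun i => ζ (i, 0)
  set ψ : ℤ → ℂ := fun i => ζ' (i, 0)
  have hφfin : (Set.range φ).Finite := hζfin.subset (by rintro _ ⟨i, rfl⟩; exact ⟨_, rfl⟩)
  have hψfin : (Set.range ψ).Finite := hζ'fin.subset (by rintro _ ⟨i, rfl⟩; exact ⟨_, rfl⟩)
  set φ' : ℤ → ℂ := fun i => α * φ (i + p) - φ (i + q) with hφ'
  set ψ' : ℤ → ℂ := fun i => β * ψ (i + q) - ψ (i + p) with hψ'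
  have hφ'fin : (Set.range φ').Finite := by
    have : φ' = act (AddMonoidAlgebra.single p α - AddMonoidAlgebra.single q 1) φ := by
      funext i
      rw [act_sub_left, Pi.sub_apply, act_single, act_single, one_mul]
    rw [this]
    exact finite_range_act _ hφfin
  have hψ'fin : (Set.range ψ').Finite := by
    have : ψ' = act (AddMonoidAlgebra.single q β - AddMonoidAlgebra.single p 1) ψ := by
      funext i
      rw [act_sub_left, Pi.sub_apply, act_single, act_single, one_mul]
    rw [this]
    exact finite_range_act _ hψfin
  -- The given relation is reduced to a one-variable recurrence along each row for products of `φ'`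
  -- and `ψ'`, which take finitely many values.
  have hper : ∀ t, p ≤ t → t ≤ q → ∃ K : ℕ, 0 < K ∧ ∀ i y : ℤ,
      φ' (i + K) * ψ' (i + K + (q - p) * y + t) = φ' i * ψ' (i + (q - p) * y + t) := by
    intro t ht1 ht2
    obtain ⟨r, F, c, hr, hsum⟩ := hrel t ht1 ht2 κ₂
    set r' : AddMonoidAlgebra ℂ ℤ := r * ((AddMonoidAlgebra.single 1 1 - 1) * h) with hr'
    have hr'0 : r' ≠ 0 := by
      refine mul_ne_zero hr (mul_ne_zero (fun h0 => ?_) hh)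
      have h1 := congrArg (fun g : AddMonoidAlgebra ℂ ℤ => g.coeff 1) h0
      simp only [AddMonoidAlgebra.one_def, AddMonoidAlgebra.coeff_sub,
        AddMonoidAlgebra.coeff_single, Finsupp.sub_apply, Finsupp.single_apply,
        AddMonoidAlgebra.coeff_zero, Finsupp.zero_apply, if_true, if_neg zero_ne_one, sub_zero,
        one_ne_zero] at h1
    obtain ⟨K, hK, hKper⟩ := exists_common_period hr'0 (finite_range_mul hφ'fin hψ'fin)
    refine ⟨K, hK, ?_⟩
    set G := graphPoly p α * graphPoly q β with hG
    set D : AddMonoidAlgebra ℂ Lattice := AddMonoidAlgebra.single (1, 0) 1 - 1 with hD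
    set ρ : Lattice → ℂ := fun u => ζ u * act (emb h) θ (u + (t, 1)) with hρ
    have hembr' : emb r' = emb r * (D * emb h) := by
      rw [hr', map_mul, map_mul, map_sub, map_one, emb_single]
    have e1 : act (D * (emb h * G)) (act F θ) = 0 := by
      rw [act_comm, act_mul, hann]
      rw [hD, act_single_sub_one_const, map_zero]
    have e2 : act (D * (emb h * G)) (fun _ => c) = 0 := by
      rw [mul_comm, act_mul, hD, act_single_sub_one_const, map_zero]
    have e3 : act (D * (emb h * G)) (act (emb r) ρ) = 0 := by
      rw [← e2, ← hsum, map_add, e1, zero_add]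
    -- The factor Y - α²X^p turns `act (emb h) θ` inside `ρ` into `ζ'` minus the constant `κ₃`; the
    -- term with `κ₃` is a multiple of a translate of `ζ` and is killed by `G`.
    have e4 : act (emb r') (act G (act (graphPoly p (α ^ 2)) ρ)) = 0 := by
      have : emb r' * G * graphPoly p (α ^ 2)
          = graphPoly p (α ^ 2) * ((D * (emb h * G)) * emb r) := by rw [hembr']; ring
      rw [← act_mul, ← act_mul, this, act_mul, act_mul, e3, map_zero]
    have e5 : act (graphPoly p (α ^ 2)) ρ
        = α • (fun u => ζ (u + (p, 0)) * ζ' (u + (t, 1))) - (α * κ₃) • fun u => ζ (u + (p, 0)) := by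
      funext u
      obtain ⟨x, y⟩ := u
      rw [hρ, act_graphPoly_sq_mul hκ₂]
      have h1 := act_translate (graphPoly p α) (act (emb h) θ) (t, 1)
      rw [h1]
      simp only [Pi.sub_apply, Pi.smul_apply, smul_eq_mul, Prod.mk_add_mk, add_zero]
      have h2 : ζ' (x + t, y + 1) = act (graphPoly p α) (act (emb h) θ) (x + t, y + 1) + κ₃ := by
        rw [hζ', mul_comm, act_mul]
      rw [h2]
      ring
    have e6 : act G (fun u => ζ (u + (p, 0))) = 0 := by
      rw [act_translate, hG, mul_comm, act_mul, hκ₂, map_zero]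
      rfl
    have e7 : act G (act (graphPoly p (α ^ 2)) ρ)
        = α • act G fun u => ζ (u + (p, 0)) * ζ' (u + (t, 1)) := by
      rw [e5, map_sub, map_smul, map_smul, e6, smul_zero, sub_zero]
    have e8 : act (emb r') (act G fun u => ζ (u + (p, 0)) * ζ' (u + (t, 1))) = 0 := by
      rw [e7, map_smul] at e4
      exact (smul_eq_zero.mp e4).resolve_left hα0
    have e9 : ∀ y : ℤ, act r' (fun x => φ' (x + 2 * p + p * y) * ψ' (x + t + 2 * q + q * y)) = 0 := by
      intro y
      have hC : β * (α * β) ^ (y + 1) ≠ 0 :=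
        mul_ne_zero hβ0 (zpow_ne_zero _ (mul_ne_zero hα0 hβ0))
      have h1 : (fun x => act G (fun u => ζ (u + (p, 0)) * ζ' (u + (t, 1))) (x, y))
          = (β * (α * β) ^ (y + 1)) •
            fun x => φ' (x + 2 * p + p * y) * ψ' (x + t + 2 * q + q * y) := by
        funext x
        rw [hG, mul_comm, act_mul, act_graphPoly_graphPoly_mul hα0 hβ0 hκ₂ hκ₃]
        simp only [Pi.smul_apply, smul_eq_mul, hφ', hψ', φ, ψ]
        ring
      have h2 : act r' (fun x => act G (fun u => ζ (u + (p, 0)) * ζ' (u + (t, 1))) (x, y)) = 0 := by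
        funext x
        rw [← act_emb, e8]
        rfl
      rw [h1, map_smul] at h2
      exact (smul_eq_zero.mp h2).resolve_left hC
    intro i y
    -- In `e9` the arguments differ by t + (q - p)(y + 2), hence the use of `y - 2`.
    have h1 := hKper _ (fun n => ⟨_, _, rfl⟩) (e9 (y - 2)) (i - 2 * p - p * (y - 2))
    have a1 : i - 2 * p - p * (y - 2) + K + 2 * p + p * (y - 2) = i + K := by ring
    have a2 : i - 2 * p - p * (y - 2) + 2 * p + p * (y - 2) = i := by ring
    have a3 : i - 2 * p - p * (y - 2) + K + t + 2 * q + q * (y - 2)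
        = i + K + (q - p) * y + t := by ring
    have a4 : i - 2 * p - p * (y - 2) + t + 2 * q + q * (y - 2) = i + (q - p) * y + t := by ring
    rw [a1, a2, a3, a4] at h1
    exact h1
  choose! K hK hKper using hper
  set M := ∏ t ∈ Finset.Icc p q, K t with hM
  have hM0 : 0 < M := Finset.prod_pos fun t ht => by
    rw [Finset.mem_Icc] at ht
    exact hK t ht.1 ht.2
  -- Division by `q - p` writes every `j - i` as `(q - p) * y + t` with p ≤ t < q, so the finitely
  -- many periods `K t` cover all relative positions.
  have hMper : ∀ i j, φ' (i + M) * ψ' (j + M) = φ' i * ψ' j := by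
    intro i j
    set t := p + (j - i - p) % (q - p) with ht
    have hm0 := Int.emod_nonneg (j - i - p) (b := q - p) (by omega)
    have hm1 := Int.emod_lt_of_pos (j - i - p) (b := q - p) (by omega)
    have htm : t ∈ Finset.Icc p q := by rw [Finset.mem_Icc]; omega
    set y := (j - i - p) / (q - p)
    have hj : j = i + (q - p) * y + t := by
      have := Int.mul_ediv_add_emod (j - i - p) (q - p)
      linarith
    obtain ⟨m, hm⟩ := Finset.dvd_prod_of_mem K htm
    have hp : Function.Periodic (fun i => φ' i * ψ' (i + (q - p) * y + t)) (K t : ℤ) := fun i =>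
      hKper t (by omega) (by omega) i y
    have h1 := hp.nat_mul m i
    have h2 : (m : ℤ) * (K t : ℤ) = (M : ℤ) := by rw [hM, hm]; push_cast; ring
    rw [h2] at h1
    rw [hj, ← h1]
    congr 2
    ring
  rcases periodic_or_periodic hpq hφfin hψfin hM0 hMper with ⟨m, hm, hφm⟩ | ⟨m, hm, hψm⟩
  · refine not_horizontally_periodic hpq.ne hα hβ hvα hh hm fun u => ?_
    obtain ⟨x, y⟩ := u
    have h1 := eq_of_act_graphPoly_eq_zero hα0 hκ₂ (x + m) y
    have h2 := eq_of_act_graphPoly_eq_zero hα0 hκ₂ x y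
    have h3 : x + m + p * y = x + p * y + m := by ring
    have h4 : ζ (x + p * y + m, 0) = ζ (x + p * y, 0) := hφm (x + p * y)
    rw [h3, h4, ← h2] at h1
    have h5 : act (emb h * graphPoly q β) θ (x + m, y)
        = act (emb h * graphPoly q β) θ (x, y) := add_right_cancel h1
    simpa using h5
  · refine not_horizontally_periodic hpq.ne' hβ hα hvβ hh hm fun u => ?_
    obtain ⟨x, y⟩ := u
    have h1 := eq_of_act_graphPoly_eq_zero hβ0 hκ₃ (x + m) y
    have h2 := eq_of_act_graphPoly_eq_zero hβ0 hκ₃ x y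
    have h3 : x + m + q * y = x + q * y + m := by ring
    have h4 : ζ' (x + q * y + m, 0) = ζ' (x + q * y, 0) := hψm (x + q * y)
    rw [h3, h4, ← h2] at h1
    have h5 : act (emb h * graphPoly p α) θ (x + m, y)
        = act (emb h * graphPoly p α) θ (x, y) := add_right_cancel h1
    simpa using h5

end Periodicity

/-! ### Linear relations from low complexity -/

section Counting

variable {A : Type*} [Finite A]

/-- If there are more than `complexity η S + m` functions of the `S`-words, they satisfy a
nontrivial linear relation subject to `m` linear constraints. -/
theorem exists_relation {k : Type*} [CommRing k] [IsDomain k] (η : Lattice → A)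
    (S : Finset Lattice) {I : Type*} [Fintype I] {m : ℕ} (b : I → words η S → k)
    (μ : (I → k) →ₗ[k] (Fin m → k)) (hcard : complexity η S + m < Fintype.card I) :
    ∃ z : I → k, z ≠ 0 ∧ (∀ w, ∑ i, z i * b i w = 0) ∧ μ z = 0 := by
  by_contra! hcon
  have : Fintype (words η S) := Fintype.ofFinite _
  let Φ : (I → k) →ₗ[k] (words η S → k) :=
    { toFun := fun z w => ∑ i, z i * b i w
      map_add' := fun z z' => by
        funext w
        simp [add_mul, Finset.sum_add_distrib]
      map_smul' := fun c z => by
        funext w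
        simp [mul_assoc, Finset.mul_sum] }
  have hinj : Function.Injective (Φ.prod μ) := by
    rw [← LinearMap.ker_eq_bot, LinearMap.ker_eq_bot']
    intro z hz
    by_contra hz0
    exact hcon z hz0 (fun w => congrFun (congrArg Prod.fst hz) w) (congrArg Prod.snd hz)
  have h1 := LinearMap.finrank_le_finrank_of_injective hinj
  rw [Module.finrank_prod, Module.finrank_fintype_fun_eq_card, Module.finrank_fintype_fun_eq_card,
    Module.finrank_fintype_fun_eq_card, Fintype.card_fin, ← Nat.card_eq_fintype_card (α := words η S),
    Nat.card_coe_set_eq] at h1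
  exact absurd hcard (not_lt.mpr h1)

section PolyOf

variable {k : Type*} [CommRing k]

/-- The Laurent polynomial with coefficients `f` on `S`. -/
noncomputable def polyOf {S : Finset Lattice} (f : S → k) : AddMonoidAlgebra k Lattice :=
  ∑ s : S, AddMonoidAlgebra.single (s : Lattice) (f s)

theorem coeff_polyOf {S : Finset Lattice} (f : S → k) (u : Lattice) :
    (polyOf f).coeff u = ∑ s : S, if (s : Lattice) = u then f s else 0 := by
  rw [polyOf, AddMonoidAlgebra.coeff_sum, Finsupp.finsetSum_apply]
  simp only [AddMonoidAlgebra.coeff_single, Finsupp.single_apply]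

theorem coeff_polyOf_coe {S : Finset Lattice} (f : S → k) (s : S) :
    (polyOf f).coeff s = f s := by
  rw [coeff_polyOf, Finset.sum_eq_single s]
  · simp
  · intro t _ hts
    rw [if_neg]
    exact fun h => hts (Subtype.ext h)
  · simp

theorem support_polyOf {S : Finset Lattice} (f : S → k) : (polyOf f).coeff.support ⊆ S := by
  intro u hu
  by_contra hS
  refine (Finsupp.mem_support_iff.mp hu) ?_
  rw [coeff_polyOf]
  refine Finset.sum_eq_zero fun s _ => if_neg ?_
  rintro rfl
  exact hS s.2

theorem act_polyOf {S : Finset Lattice} (f : S → k) (e : Lattice → k) (u : Lattice) :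
    act (polyOf f) e u = ∑ s : S, f s * e (u + s) := by
  rw [polyOf, map_sum, LinearMap.sum_apply, Finset.sum_apply]
  simp only [act_single]

end PolyOf

/-- Low complexity gives an integer polynomial acting by a constant. -/
theorem exists_integer_annihilator (ι : A → ℤ) (η : Lattice → A) (S : Finset Lattice)
    (hS : complexity η S ≤ S.card) :
    ∃ F : AddMonoidAlgebra ℤ Lattice, F ≠ 0 ∧ F.coeff.support ⊆ S ∧
      ∃ c, act F (fun u => ι (η u)) = fun _ => c := by
  -- Integer coefficients are needed for the reduction modulo primes. The index `none` stands for
  -- the constant function 1, which brings the number of functions to `S.card + 1`.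
  obtain ⟨z, hz0, hz, -⟩ := exists_relation (k := ℤ) η S (I := Option S) (m := 0)
    (fun i w => i.elim 1 fun s => ι (w.1 s)) 0 (by
      rw [Fintype.card_option, Fintype.card_coe]; omega)
  have hact : ∀ u, z none + act (polyOf fun s => z (some s)) (fun u => ι (η u)) u = 0 := by
    intro u
    have h1 := hz ⟨fun x : S => translate u η x, u, rfl⟩
    rw [Fintype.sum_option] at h1
    rw [act_polyOf]
    simpa [translate, add_comm] using h1
  refine ⟨polyOf fun s => z (some s), fun h0 => hz0 ?_, support_polyOf _, - z none, ?_⟩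
  · funext i
    cases i with
    | none => simpa [h0] using hact 0
    | some s =>
      have := coeff_polyOf_coe (fun s => z (some s)) s
      rw [h0] at this
      exact this.symm
  · funext u
    linarith [hact u]

end Counting

/-! ### Factorisation of three-row polynomials -/

section RowRelations

theorem coeff_emb_mul_single (g : AddMonoidAlgebra ℂ ℤ) (b : ℤ) :
    emb g * AddMonoidAlgebra.single (0, b) 1
      = AddMonoidAlgebra.mapDomain (fun a => (a, b)) g := by
  induction g using AddMonoidAlgebra.induction_linear with
  | zero => simp
  | add f g hf hg => rw [map_add, add_mul, hf, hg, AddMonoidAlgebra.mapDomain_add]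
  | single a c =>
    rw [emb_single, AddMonoidAlgebra.single_mul_single, AddMonoidAlgebra.mapDomain_single]
    simp

theorem eq_sum_rows (F : AddMonoidAlgebra ℂ Lattice) {T : Finset ℤ}
    (hT : ∀ s ∈ F.coeff.support, s.2 ∈ T) :
    F = ∑ b ∈ T, emb (row F b) * AddMonoidAlgebra.single (0, b) 1 := by
  refine AddMonoidAlgebra.ext (Finsupp.ext fun u => ?_)
  obtain ⟨x, y⟩ := u
  rw [AddMonoidAlgebra.coeff_sum, Finsupp.finsetSum_apply]
  have hinj : ∀ b : ℤ, Function.Injective fun a : ℤ => (a, b) := fun b _ _ h =>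
    (Prod.ext_iff.mp h).1
  have h1 : ∀ b, b ≠ y → (emb (row F b) * AddMonoidAlgebra.single (0, b) 1).coeff (x, y) = 0 := by
    intro b hb
    rw [coeff_emb_mul_single, AddMonoidAlgebra.coeff_mapDomain]
    refine Finsupp.mapDomain_of_notMem_range _ _ ?_
    rintro ⟨a, ha⟩
    exact hb (Prod.ext_iff.mp ha).2
  have h2 : (emb (row F y) * AddMonoidAlgebra.single (0, y) 1).coeff (x, y) = F.coeff (x, y) := by
    rw [coeff_emb_mul_single, AddMonoidAlgebra.coeff_mapDomain]
    exact Finsupp.mapDomain_apply (hinj y) _ x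
  by_cases hy : y ∈ T
  · rw [Finset.sum_eq_single_of_mem y hy fun b _ hb => h1 b hb, h2]
  · rw [Finset.sum_eq_zero fun b hb => h1 b fun h => hy (h ▸ hb)]
    by_contra hne
    exact hy (hT (x, y) (by simpa using hne))

variable {θ : Lattice → ℂ} {p q : ℤ} {α β : ℂ}

/-- A three-row Laurent polynomial that acts by a constant is a multiple of the product of the two
graph polynomials. -/
theorem row_relations (hpq : p < q) (hα : ‖α‖ = 1)
    (hβ : ‖β‖ = 1) (hvα : VanishOnCurve θ (-p, 1) α) (hvβ : VanishOnCurve θ (-q, 1) β)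
    {F : AddMonoidAlgebra ℂ Lattice} (hF : ∀ s ∈ F.coeff.support, s.2 ∈ ({0, 1, 2} : Finset ℤ))
    {c : ℂ} (hFθ : act F θ = fun _ => c) :
    row F 1 = -((AddMonoidAlgebra.single p α + AddMonoidAlgebra.single q β) * row F 2) ∧
      F = emb (row F 2) * (graphPoly p α * graphPoly q β) := by
  have hα0 : α ≠ 0 := by rintro rfl; simp at hα
  have hβ0 : β ≠ 0 := by rintro rfl; simp at hβ
  -- Over |x| > 1 the quadratic in y has the distinct roots αx^p and βx^q; these are Vieta's
  -- formulas.
  have key : ∀ x : ℂˣ, 1 < ‖(x : ℂ)‖ →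
      evalOne x (row F 1) = -((α * (x : ℂ) ^ p + β * (x : ℂ) ^ q) * evalOne x (row F 2)) ∧
      evalOne x (row F 0) = α * (x : ℂ) ^ p * (β * (x : ℂ) ^ q) * evalOne x (row F 2) := by
    intro x hx
    have hxp : (x : ℂ) ^ p ≠ 0 := zpow_ne_zero _ x.ne_zero
    have hxq : (x : ℂ) ^ q ≠ 0 := zpow_ne_zero _ x.ne_zero
    have c1 : (x : ℂ) ^ (-p) * (α * (x : ℂ) ^ p) ^ (1 : ℤ) = α := by
      rw [zpow_neg, zpow_one]; field_simp
    have c2 : (x : ℂ) ^ (-q) * (β * (x : ℂ) ^ q) ^ (1 : ℤ) = β := by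
      rw [zpow_neg, zpow_one]; field_simp
    have e1 := hvα.eval_eq_zero_of_const hFθ hx
      (y := Units.mk0 (α * (x : ℂ) ^ p) (mul_ne_zero hα0 hxp)) c1
    have e2 := hvβ.eval_eq_zero_of_const hFθ hx
      (y := Units.mk0 (β * (x : ℂ) ^ q) (mul_ne_zero hβ0 hxq)) c2
    have hne : α * (x : ℂ) ^ p - β * (x : ℂ) ^ q ≠ 0 := by
      intro h
      have c3 : (x : ℂ) ^ (-q) *
          ((Units.mk0 (α * (x : ℂ) ^ p) (mul_ne_zero hα0 hxp) : ℂˣ) : ℂ) ^ (1 : ℤ) = β := by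
        rw [Units.val_mk0, sub_eq_zero.mp h, c2]
      have h5 := parallel_of_common_point (v := (-p, 1)) (w := (-q, 1)) hα hβ hx c1 c3
      simp at h5
      omega
    rw [evalTwo_eq_sum_rows x _ F hF] at e1 e2
    simp only [Finset.sum_insert, Finset.mem_insert, Finset.mem_singleton, Finset.sum_singleton,
      zero_ne_one, OfNat.zero_ne_ofNat, OfNat.one_ne_ofNat, or_self, not_false_eq_true,
      zpow_ofNat, Units.val_mk0] at e1 e2
    generalize α * (x : ℂ) ^ p = y₁ at *
    generalize β * (x : ℂ) ^ q = y₂ at *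
    have f1 : evalOne x (row F 1) + (y₁ + y₂) * evalOne x (row F 2) = 0 :=
      (mul_eq_zero.mp (by linear_combination e1 - e2 :
        (y₁ - y₂) * (evalOne x (row F 1) + (y₁ + y₂) * evalOne x (row F 2)) = 0)).resolve_left hne
    exact ⟨by linear_combination f1, by linear_combination e1 - y₁ * f1⟩
  have E1 : row F 1 = -((AddMonoidAlgebra.single p α + AddMonoidAlgebra.single q β) * row F 2) := by
    rw [← sub_eq_zero]
    refine eq_zero_of_evalOne_eq_zero fun x hx => ?_
    rw [map_sub, map_neg, map_mul, map_add, evalOne_single, evalOne_single, (key x hx).1, sub_self]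
  have E0 : row F 0 = AddMonoidAlgebra.single p α * AddMonoidAlgebra.single q β * row F 2 := by
    rw [← sub_eq_zero]
    refine eq_zero_of_evalOne_eq_zero fun x hx => ?_
    rw [map_sub, map_mul, map_mul, evalOne_single, evalOne_single, (key x hx).2, sub_self]
  refine ⟨E1, ?_⟩
  conv_lhs => rw [eq_sum_rows F hF]
  have hY : (AddMonoidAlgebra.single (0, 2) 1 : AddMonoidAlgebra ℂ Lattice)
      = AddMonoidAlgebra.single (0, 1) 1 * AddMonoidAlgebra.single (0, 1) 1 := by
    rw [AddMonoidAlgebra.single_mul_single]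
    simp
  have h1 : (AddMonoidAlgebra.single (0, 0) 1 : AddMonoidAlgebra ℂ Lattice) = 1 := rfl
  simp only [Finset.sum_insert, Finset.mem_insert, Finset.mem_singleton, Finset.sum_singleton,
      zero_ne_one, OfNat.zero_ne_ofNat, OfNat.one_ne_ofNat, or_self, not_false_eq_true]
  rw [E1, E0, hY, h1]
  simp only [map_neg, map_mul, map_add, emb_single, graphPoly]
  ring

/-- Row 1 is -(αX^p + βX^q) times row 2. As p < q, its extreme terms, at `lo + p` and `hi + q`, do
not cancel, so they also lie in [0, n - 1]. -/
theorem row_two_support (hpq : p < q) (hα : ‖α‖ = 1)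
    (hβ : ‖β‖ = 1) (hvα : VanishOnCurve θ (-p, 1) α) (hvβ : VanishOnCurve θ (-q, 1) β)
    {n : ℕ} {F : AddMonoidAlgebra ℂ Lattice} (hF : F.coeff.support ⊆ rect n 3)
    {c : ℂ} (hFθ : act F θ = fun _ => c) {a : ℤ} (ha : F.coeff (a, 2) ≠ 0) :
    max 0 (-p) ≤ a ∧ a ≤ n - 1 - max 0 q := by
  have hα0 : α ≠ 0 := by rintro rfl; simp at hα
  have hβ0 : β ≠ 0 := by rintro rfl; simp at hβ
  have hmem : ∀ s, F.coeff s ≠ 0 → 0 ≤ s.1 ∧ s.1 < n ∧ 0 ≤ s.2 ∧ s.2 < 3 := by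
    intro s hs
    have := hF (Finsupp.mem_support_iff.mpr hs)
    simp only [rect, Finset.mem_product, Finset.mem_Ico] at this
    exact ⟨this.1.1, this.1.2, this.2.1, by simpa using this.2.2⟩
  have hrows : ∀ s ∈ F.coeff.support, s.2 ∈ ({0, 1, 2} : Finset ℤ) := by
    intro s hs
    have := hmem s (Finsupp.mem_support_iff.mp hs)
    simp only [Finset.mem_insert, Finset.mem_singleton]
    omega
  have hrel : ∀ k, F.coeff (k, 1) = -(α * F.coeff (k - p, 2) + β * F.coeff (k - q, 2)) := by
    intro k
    have h1 := congrArg (fun g => g.coeff k) (row_relations hpq hα hβ hvα hvβ hrows hFθ).1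
    simp only [AddMonoidAlgebra.coeff_neg, Finsupp.neg_apply, add_mul, AddMonoidAlgebra.coeff_add,
      Finsupp.add_apply, AddMonoidAlgebra.coeff_single_mul_apply, coeff_row] at h1
    rw [h1]
    congr 5 <;> ring
  have hne : (row F 2).coeff.support.Nonempty := ⟨a, by simpa using ha⟩
  obtain ⟨lo, hlo, hmin⟩ := Finset.exists_min_image _ id hne
  obtain ⟨hi, hhi, hmax⟩ := Finset.exists_max_image _ id hne
  simp only [id, Finsupp.mem_support_iff, coeff_row] at hlo hmin hhi hmax
  have b1 : F.coeff (lo + p, 1) ≠ 0 := by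
    have h0 : F.coeff (lo + p - q, 2) = 0 := by
      by_contra h
      have := hmin _ h
      omega
    rw [hrel, h0, add_sub_cancel_right, mul_zero, add_zero]
    exact neg_ne_zero.mpr (mul_ne_zero hα0 hlo)
  have b2 : F.coeff (hi + q, 1) ≠ 0 := by
    have h0 : F.coeff (hi + q - p, 2) = 0 := by
      by_contra h
      have := hmax _ h
      omega
    rw [hrel, h0, add_sub_cancel_right, mul_zero, zero_add]
    exact neg_ne_zero.mpr (mul_ne_zero hβ0 hhi)
  have m1 := hmem _ b1
  have m2 := hmem _ b2
  have m3 := hmem _ ha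
  have l1 := hmin a ha
  have l2 := hmax a ha
  simp only at m1 m2 m3
  omega

end RowRelations

/-! ### Product relations and the final contradiction -/

section Conclusion

variable {A : Type*} [Finite A]

theorem mem_rect {n k : ℕ} {s : Lattice} :
    s ∈ rect n k ↔ (0 ≤ s.1 ∧ s.1 < n) ∧ 0 ≤ s.2 ∧ s.2 < k := by
  simp only [rect, Finset.mem_product, Finset.mem_Ico]

theorem card_rect (n k : ℕ) : (rect n k).card = n * k := by
  simp [rect]

/-- Low complexity produces the linear relations between products excluded by
`false_of_product_relations`. -/
theorem exists_product_relations {ι : A → ℤ} {η : Lattice → A} {n : ℕ}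
    (hn : complexity η (rect n 3) ≤ 3 * n) {p q : ℤ} (hpq : p < q) {α β : ℂ} (hα : ‖α‖ = 1)
    (hβ : ‖β‖ = 1) (hvα : VanishOnCurve (fun u => (ι (η u) : ℂ)) (-p, 1) α)
    (hvβ : VanishOnCurve (fun u => (ι (η u) : ℂ)) (-q, 1) β)
    {F₀ : AddMonoidAlgebra ℂ Lattice} (hF₀ : F₀ ≠ 0) (hF₀S : F₀.coeff.support ⊆ rect n 3) {c₀ : ℂ}
    (hF₀θ : act F₀ (fun u => (ι (η u) : ℂ)) = fun _ => c₀) :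
    ∃ h : AddMonoidAlgebra ℂ ℤ, h ≠ 0 ∧
      (∃ κ, act (emb h * (graphPoly p α * graphPoly q β)) (fun u => (ι (η u) : ℂ)) = fun _ => κ) ∧
      ∀ t, p ≤ t → t ≤ q → ∀ κ' : ℂ, ∃ (r : AddMonoidAlgebra ℂ ℤ)
        (F : AddMonoidAlgebra ℂ Lattice) (c : ℂ), r ≠ 0 ∧
        act F (fun u => (ι (η u) : ℂ)) + act (emb r) (fun u =>
          (act (emb h * graphPoly q β) (fun u => (ι (η u) : ℂ)) u + κ')
          * act (emb h) (fun u => (ι (η u) : ℂ)) (u + (t, 1))) = fun _ => c := by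
  classical
  set θ : Lattice → ℂ := fun u => (ι (η u) : ℂ) with hθ
  set L : ℤ := max 0 (-p) with hL
  set U : ℤ := n - 1 - max 0 q with hU
  have hrows : ∀ {F : AddMonoidAlgebra ℂ Lattice}, F.coeff.support ⊆ rect n 3 →
      ∀ s ∈ F.coeff.support, s.2 ∈ ({0, 1, 2} : Finset ℤ) := by
    intro F hF s hs
    have := mem_rect.mp (hF hs)
    simp only [Finset.mem_insert, Finset.mem_singleton]
    have h3 : ((3 : ℕ) : ℤ) = 3 := rfl
    omega
  have hsupp : ∀ {F : AddMonoidAlgebra ℂ Lattice} {c : ℂ}, F.coeff.support ⊆ rect n 3 →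
      act F θ = (fun _ => c) → ∀ a, F.coeff (a, 2) ≠ 0 → L ≤ a ∧ a ≤ U := fun hF hFθ a ha =>
    row_two_support hpq hα hβ hvα hvβ hF hFθ ha
  have hprod : ∀ {F : AddMonoidAlgebra ℂ Lattice} {c : ℂ}, F.coeff.support ⊆ rect n 3 →
      act F θ = (fun _ => c) → F = emb (row F 2) * (graphPoly p α * graphPoly q β) :=
    fun hF hFθ => (row_relations hpq hα hβ hvα hvβ (hrows hF) hFθ).2
  have htop : ∀ {F : AddMonoidAlgebra ℂ Lattice} {c : ℂ}, F.coeff.support ⊆ rect n 3 →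
      act F θ = (fun _ => c) → F ≠ 0 → ∃ a, F.coeff (a, 2) ≠ 0 := by
    intro F c hF hFθ hF0
    by_contra! hcon
    have h1 : row F 2 = 0 := AddMonoidAlgebra.ext (Finsupp.ext hcon)
    rw [hprod hF hFθ, h1] at hF0
    simp at hF0
  -- `d` will be the least width of a top row; its minimality later forces a product into the
  -- relation.
  have hex : ∃ d : ℕ, ∃ F : AddMonoidAlgebra ℂ Lattice, F ≠ 0 ∧ F.coeff.support ⊆ rect n 3 ∧
      (∃ c, act F θ = fun _ => c) ∧ ∀ a, F.coeff (a, 2) ≠ 0 → L ≤ a ∧ a ≤ L + d :=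
    ⟨(U - L).toNat, F₀, hF₀, hF₀S, ⟨c₀, hF₀θ⟩, fun a ha => by
      have := hsupp hF₀S hF₀θ a ha
      omega⟩
  set d := Nat.find hex with hd
  obtain ⟨F₁, hF₁, hF₁S, ⟨κ, hF₁θ⟩, hF₁d⟩ := Nat.find_spec hex
  rw [← hd] at hF₁d
  have hdU : L + d ≤ U := by
    obtain ⟨a, ha⟩ := htop hF₀S hF₀θ hF₀
    have h1 := hsupp hF₀S hF₀θ a ha
    have h2 : d ≤ (U - L).toNat := Nat.find_min' hex ⟨F₀, hF₀, hF₀S, ⟨c₀, hF₀θ⟩, fun a ha => by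
      have := hsupp hF₀S hF₀θ a ha
      omega⟩
    omega
  set h := row F₁ 2 with hh
  have hh0 : h ≠ 0 := by
    intro h0
    apply hF₁
    rw [hprod hF₁S hF₁θ, ← hh, h0]
    simp
  refine ⟨h, hh0, ⟨κ, by rw [hh, ← hprod hF₁S hF₁θ, hF₁θ]⟩, fun t ht1 ht2 κ' => ?_⟩
  -- The number of translates of the window [L, L + d] inside [L, U].
  set m := (U - L - d + 1).toNat with hm
  have hsuppR : ∀ (j : Fin m), ((L + d + (j : ℕ), 2) : Lattice) ∈ rect n 3 := by
    intro j
    have hj : (j : ℕ) < m := j.2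
    rw [mem_rect]
    have h3 : ((3 : ℕ) : ℤ) = 3 := rfl
    simp only
    omega
  let ext : words η (rect n 3) → Lattice → ℂ := fun w u =>
    if hu : u ∈ rect n 3 then (ι (w.1 ⟨u, hu⟩) : ℂ) else 0
  let word : Lattice → words η (rect n 3) := fun u => ⟨fun x => translate u η x, u, rfl⟩
  have hext : ∀ u s, s ∈ rect n 3 → ext (word u) s = θ (u + s) := by
    intro u s hs
    simp only [ext, dif_pos hs, word, translate, hθ]
    rw [add_comm]
  let b : (Option (rect n 3) ⊕ Fin m) → words η (rect n 3) → ℂ := fun i w =>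
    Sum.elim (fun o => o.elim 1 fun s => ext w s) (fun k : Fin m =>
      (∑ a ∈ h.coeff.support, h.coeff a
          * (ext w (a + (k : ℕ), 1) - β * ext w (a + (k : ℕ) + q, 0)) + κ')
        * ∑ a ∈ h.coeff.support, h.coeff a * ext w (a + (k : ℕ) + t, 1)) i
  let μ : (Option (rect n 3) ⊕ Fin m → ℂ) →ₗ[ℂ] (Fin m → ℂ) :=
    LinearMap.funLeft ℂ ℂ fun j => Sum.inl (some ⟨_, hsuppR j⟩)
  -- There are 3n + 1 + m unknowns, at most 3n equations from words, and m constraints making the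
  -- coefficients in row 2 vanish at positions L + d, …, U.
  obtain ⟨z, hz0, hz, hzμ⟩ := exists_relation η (rect n 3) b μ (by
    rw [Fintype.card_sum, Fintype.card_option, Fintype.card_coe, card_rect, Fintype.card_fin]
    omega)
  set F := polyOf fun s => z (Sum.inl (some s)) with hF
  set ρ : Lattice → ℂ := fun u => (act (emb h * graphPoly q β) θ u + κ')
    * act (emb h) θ (u + (t, 1)) with hρ
  have hb : ∀ (x y : ℤ) (k : Fin m), b (Sum.inr k) (word (x, y)) = ρ (x + (k : ℕ), y) := by
    intro x y k
    have hk : (k : ℕ) < m := k.2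
    -- By the definition of `L` and `U`, positions in [L, U] stay inside the rectangle after a shift
    -- by `q`, or by any `t` with p ≤ t ≤ q. Each product therefore depends only on the word.
    have hwin : ∀ a ∈ h.coeff.support, L ≤ a + (k : ℕ) ∧ a + (k : ℕ) ≤ U := by
      intro a ha
      have ha' : h.coeff a ≠ 0 := Finsupp.mem_support_iff.mp ha
      have := hF₁d a ha'
      omega
    simp only [b, hρ, Sum.elim_inr, act_mul, Prod.mk_add_mk, act_emb]
    rw [act_apply, act_apply, Finsupp.sum, Finsupp.sum]
    have h3 : ((3 : ℕ) : ℤ) = 3 := rfl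
    refine congrArg₂ (· * ·) (congrArg (· + κ') (Finset.sum_congr rfl fun a ha => ?_))
      (Finset.sum_congr rfl fun a ha => ?_)
    · have := hwin a ha
      rw [hext _ _ (by rw [mem_rect]; simp only; omega),
        hext _ _ (by rw [mem_rect]; simp only; omega), act_graphPoly]
      simp only [Prod.mk_add_mk]
      congr 3
      · congr 1; ring
      · congr 1
        refine Prod.ext ?_ ?_ <;> simp only <;> ring
    · have := hwin a ha
      rw [hext _ _ (by rw [mem_rect]; simp only; omega)]
      simp only [Prod.mk_add_mk]
      congr 3
      ring
  have hrel : ∀ x y : ℤ, z (Sum.inl none) + act F θ (x, y)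
      + ∑ k : Fin m, z (Sum.inr k) * ρ (x + (k : ℕ), y) = 0 := by
    intro x y
    have h1 := hz (word (x, y))
    rw [Fintype.sum_sum_type, Fintype.sum_option] at h1
    simp only [hb] at h1
    rw [← h1, hF, act_polyOf]
    congr 2
    · simp [b]
    · refine Finset.sum_congr rfl fun s _ => ?_
      simp only [b, Sum.elim_inl, Option.elim_some]
      rw [hext _ _ s.2]
  -- Without products `F` would act by a constant, with its top row in [L, L + d - 1] because of
  -- `μ`, contradicting the minimality of `d`.
  have hr : ∃ k, z (Sum.inr k) ≠ 0 := by
    by_contra! hcon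
    have hFθ : act F θ = fun _ => - z (Sum.inl none) := by
      funext u
      have h1 := hrel u.1 u.2
      simp only [hcon, zero_mul, Finset.sum_const_zero, add_zero] at h1
      linear_combination h1
    have hFS : F.coeff.support ⊆ rect n 3 := support_polyOf _
    have hF0 : F = 0 := by
      by_contra hF0
      have hlt : ∀ a, F.coeff (a, 2) ≠ 0 → a < L + d := by
        intro a ha
        by_contra hge
        have h1 := hsupp hFS hFθ a ha
        have h2 := congrFun hzμ ⟨(a - L - d).toNat, by omega⟩
        have h3 := coeff_polyOf_coe (fun s => z (Sum.inl (some s)))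
          ⟨_, hsuppR ⟨(a - L - d).toNat, by omega⟩⟩
        have h4 : L + d + ((a - L - d).toNat : ℤ) = a := by omega
        apply ha
        rw [← h4]
        exact h3.trans h2
      obtain ⟨a, ha⟩ := htop hFS hFθ hF0
      have h1 := hsupp hFS hFθ a ha
      have h2 := hlt a ha
      refine Nat.find_min hex (m := d - 1) (by omega) ⟨F, hF0, hFS, ⟨_, hFθ⟩, fun a' ha' => ?_⟩
      have h3 := hsupp hFS hFθ a' ha'
      have h4 := hlt a' ha'
      omega
    apply hz0
    funext i
    rcases i with (_ | s) | k
    · have h1 := congrFun hFθ 0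
      rw [hF0] at h1
      simpa using h1
    · have h1 := coeff_polyOf_coe (fun s => z (Sum.inl (some s))) s
      rw [← hF, hF0] at h1
      exact h1.symm
    · exact hcon k
  obtain ⟨k₀, hk₀⟩ := hr
  refine ⟨∑ k : Fin m, AddMonoidAlgebra.single ((k : ℕ) : ℤ) (z (Sum.inr k)), F,
    - z (Sum.inl none), ?_, ?_⟩
  · intro h0
    have h1 := congrArg (fun g : AddMonoidAlgebra ℂ ℤ => g.coeff ((k₀ : ℕ) : ℤ)) h0
    simp only [AddMonoidAlgebra.coeff_sum, Finsupp.finsetSum_apply, AddMonoidAlgebra.coeff_single,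
      Finsupp.single_apply, AddMonoidAlgebra.coeff_zero, Finsupp.zero_apply] at h1
    rw [Finset.sum_eq_single k₀] at h1
    · rw [if_pos rfl] at h1
      exact hk₀ h1
    · intro k _ hk
      rw [if_neg]
      intro h2
      exact hk (Fin.ext (by exact_mod_cast h2))
    · simp
  · funext u
    obtain ⟨x, y⟩ := u
    rw [Pi.add_apply, act_emb, map_sum, LinearMap.sum_apply, Finset.sum_apply]
    simp only [act_single]
    linear_combination hrel x y

/-- Three nonexpansive lines force complexity greater than `3 n` on `n × 3` rectangles. -/
theorem lt_complexity_of_three_nonexpansiveLines (η : Lattice → A)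
    (h : (nonexpansiveLines η).ncard = 3) (n : ℕ) : 3 * n < complexity η (rect n 3) := by
  by_contra hcon
  rw [not_lt] at hcon
  obtain ⟨ι, hι⟩ : ∃ ι : A → ℤ, Function.Injective ι := by
    obtain ⟨m, ⟨e⟩⟩ := Finite.exists_equiv_fin A
    exact ⟨fun a => ((e a : ℕ) : ℤ), fun a a' haa' => e.injective (Fin.ext (Int.ofNat_inj.mp haa'))⟩
  obtain ⟨F, hF0, hFS, c, hFη⟩ := exists_integer_annihilator ι η (rect n 3)
    (by rw [card_rect]; omega)
  obtain ⟨ℓ₁, ℓ₂, ℓ₃, h12, h13, h23, hset⟩ := Set.ncard_eq_three.mp h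
  have hann : act ((AddMonoidAlgebra.single (1, 0) 1 - 1) * F) (fun u => ι (η u)) = 0 := by
    rw [act_mul, hFη, act_single_sub_one_const]
  have hann0 : (AddMonoidAlgebra.single (1, 0) 1 - 1) * F ≠ 0 := by
    refine mul_ne_zero (fun h0 => ?_) hF0
    have h1 := congrArg (fun g : AddMonoidAlgebra ℤ Lattice => g.coeff (1, 0)) h0
    simp [AddMonoidAlgebra.one_def] at h1
  let ℓ : Fin 3 → AffineSubspace ℝ Plane := ![ℓ₁, ℓ₂, ℓ₃]
  have hℓinj : Function.Injective ℓ := by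
    intro i j hij
    fin_cases i <;> fin_cases j <;> simp_all [ℓ]
  have hℓ : ∀ i, IsNonexpansiveLine η (ℓ i) ∧ (0 : Plane) ∈ ℓ i := by
    intro i
    have : ℓ i ∈ nonexpansiveLines η := by
      rw [hset]
      fin_cases i <;> simp [ℓ]
    exact this
  choose v hcop hvℓ ω hω hvan using fun i =>
    (hℓ i).1.exists_vanishOnCurve hι (hℓ i).2 hann0 hann
  have hpar : ∀ i j, i ≠ j → (v i).1 * (v j).2 ≠ (v i).2 * (v j).1 := fun i j hij hpar =>
    hij (hℓinj (eq_of_parallel (hℓ i).1.1 (hℓ j).1.1 (hℓ i).2 (hℓ j).2 (hcop i) (hcop j)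
      (hvℓ i) (hvℓ j) hpar))
  set Fc : AddMonoidAlgebra ℂ Lattice :=
    AddMonoidAlgebra.mapRingHom Lattice (Int.castRingHom ℂ) F with hFc
  have hcoeff : ∀ s, Fc.coeff s = (F.coeff s : ℂ) := fun s => by simp [hFc]
  have hsuppc : Fc.coeff.support = F.coeff.support := by
    ext s
    simp [hcoeff]
  have hFc0 : Fc ≠ 0 := by
    intro h0
    apply hF0
    refine AddMonoidAlgebra.ext (Finsupp.ext fun s => ?_)
    have h1 := hcoeff s
    rw [h0] at h1
    exact Int.cast_eq_zero.mp h1.symm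
  have hFcη : act Fc (fun u => (ι (η u) : ℂ)) = fun _ => (c : ℂ) := by
    funext u
    have h1 := congrFun hFη u
    rw [act_apply, Finsupp.sum] at h1
    rw [act_apply, Finsupp.sum, hsuppc, ← h1]
    push_cast
    exact Finset.sum_congr rfl fun s _ => by rw [hcoeff]
  have hFcS : Fc.coeff.support ⊆ rect n 3 := hsuppc ▸ hFS
  obtain ⟨p, q, α, β, hpq, hα, hβ, hvα, hvβ⟩ := exists_two_graphs hFc0 (fun s hs => by
    have := mem_rect.mp (hFcS hs)
    have h3 : ((3 : ℕ) : ℤ) = 3 := rfl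
    simp only [Finset.mem_insert, Finset.mem_singleton]
    omega) hFcη hω hvan hpar
  obtain ⟨h, hh, ⟨κ, hκ⟩, hrel⟩ :=
    exists_product_relations hcon hpq hα hβ hvα hvβ hFc0 hFcS hFcη
  refine false_of_product_relations hpq hα hβ ?_ hvα hvβ hh hκ hrel
  refine (Set.finite_range fun a => (ι a : ℂ)).subset ?_
  rintro _ ⟨u, rfl⟩
  exact ⟨η u, rfl⟩

end Conclusion

end Nivat

theorem mainTheorem3 {A : Type*} [Finite A] (η : ℤ × ℤ → A)
    (h : (Nivat.nonexpansiveLines η).ncard = 3) (n : ℕ) :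
    3 * n < Nivat.complexity η (Nivat.rect n 3) :=
  Nivat.lt_complexity_of_three_nonexpansiveLines η h n
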